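/- Let $0\le m\le n$, let $X$ be an $n$-dimensional real-analytic manifold, and let $F:\mathrm{T}X\to\mathbb R^{n-m}$ be meromorphic (locally a quotient of analytic functions in each component). Let $x=(x_1,\dots,x_n)$ be local coordinates of $X$. Over their domain, let $\mathfrak X=X\times\mathbb R^n_\infty$ have coordinates $\overline x=(x,\dot x,\ddot x,\dots)$, the product topology and the trivial Cartan field $\tau_{\mathfrak X}=\sum_{i}\sum_{j\ge 0}x_i^{(j+1)}\,\partial/\partial x_i^{(j)}$. Let $\mathfrak X_0\subset\mathfrak X$ be the set of points at which $F$ is regular (analytic) and $\tau_{\mathfrak X}^kF=0$ for all $k\ge 0$. For a set $S$ of jets, let $\mathcal O(S)$ be the algebra of functions on $S$ of the form $g(x,\dot x,\dots,x^{(k)})$ with $k$ finite and $g$ analytic at every point of (the truncation of) $S$. A Lie–Bäcklund isomorphism between two such sets is a bijection such that it and its inverse have components in the respective algebras $\mathcal O$ and carry the trivial Cartan field of the source to that of the target. Let $V$ be an open subset of $\mathfrak X_0$ containing a point $\mathfrak x_0$, and assume that $\partial F/\partial\dot x$ has rank $n-m$ at every point of $V$. Suppose that the system $F(x,\dot x)=0$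 is flat on $V$, i.e. that there is a Lie–Bäcklund isomorphism between $V$ and an open subset of the trivial system $\mathbb R^m_\infty$ with coordinates $(y,\dot y,\ddot y,\dots)$ and its trivial Cartan field. Then $\tau_{\mathfrak X}$ restricts to a derivation $\tau$ of $\mathcal O(V)$, and the variational matrix $$P(F)=\frac{\partial F}{\partial x}+\frac{\partial F}{\partial\dot x}\,\tau,$$ with entries in the ring $\mathcal O(V)[\tau]$ of polynomials in $\tau$ subject to $\tau a=a\tau+\tau(a)$, is hyper-regular on $V$: there is an $n\times n$ matrix $U$ over $\mathcal O(V)[\tau]$, invertible over $\mathcal O(V)[\tau]$ (unimodular), such that $P(F)\,U=\begin{bmatrix}I_{n-m}&0_{(n-m)\times m}\end{bmatrix}$. -/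

import Mathlib

open Set Filter Topology Polynomial
open scoped Manifold ContDiff

noncomputable section

namespace FlatSystem

/-! ### Jets and the trivial Cartan field -/

/-- Points `(x, ẋ, ẍ, …)` of `ℝⁿ × ℝⁿ_∞`, with the product topology. -/
abbrev Jet (n : ℕ) : Type := ℕ → Fin n → ℝ

/-- The truncation `(x, ẋ, …, x^(k))` of a jet. -/
def trunc {n : ℕ} (k : ℕ) (x : Jet n) : Fin (k + 1) → Fin n → ℝ := fun j => x j

/-- The value at `x` of the trivial Cartan field `∑ x_i^(j+1) ∂/∂x_i^(j)`, as a tangent vector. -/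
def shift {n : ℕ} (x : Jet n) : Jet n := fun j => x (j + 1)

/-- The trivial Cartan field acting on functions of `(x, ẋ, ẍ, …)`: the derivative of `a` at `x`
in the direction `(ẋ, ẍ, …)`. For a differentiable function of finitely many of the coordinates
this is `∑ x_i^(j+1) ∂a/∂x_i^(j)`. -/
def cartan {n : ℕ} {G : Type*} [NormedAddCommGroup G] [NormedSpace ℝ G] (a : Jet n → G) :
    Jet n → G :=
  fun x => lineDeriv ℝ a x (shift x)

/-! ### Analytic functions of finite order on a set of jets -/

/-- On `S`, the function `a` is `g(x, ẋ, …, x^(k))`, with `g` analytic at all points concerned. -/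
def Represents {n : ℕ} (S : Set (Jet n)) (a : S → ℝ) (k : ℕ)
    (g : (Fin (k + 1) → Fin n → ℝ) → ℝ) : Prop :=
  ∀ p : S, AnalyticAt ℝ g (trunc k p.1) ∧ a p = g (trunc k p.1)

theorem Represents.lift {n : ℕ} {S : Set (Jet n)} {a : S → ℝ} {k : ℕ}
    {g : (Fin (k + 1) → Fin n → ℝ) → ℝ} (h : Represents S a k g) {l : ℕ} (hkl : k ≤ l) :
    ∃ g', Represents S a l g' := by
  let L : (Fin (l + 1) → Fin n → ℝ) →L[ℝ] (Fin (k + 1) → Fin n → ℝ) :=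
    ContinuousLinearMap.pi fun j =>
      ContinuousLinearMap.proj (R := ℝ) (φ := fun _ : Fin (l + 1) => Fin n → ℝ)
        (Fin.castLE (by omega) j)
  have hL : ∀ x : Jet n, L (trunc l x) = trunc k x := fun x => rfl
  refine ⟨fun z => g (L z), fun p => ⟨?_, ?_⟩⟩
  · have h1 : AnalyticAt ℝ g (L (trunc l p.1)) := by rw [hL]; exact (h p).1
    exact h1.comp (L.analyticAt _)
  · simp only [hL]; exact (h p).2

/-- The algebra `O(S)` of the functions on `S` that are restrictions of analytic functions of
finitely many of the coordinates `x, ẋ, ẍ, …`. -/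
def regularFunctions {n : ℕ} (S : Set (Jet n)) : Subalgebra ℝ (S → ℝ) where
  carrier := {a | ∃ k g, Represents S a k g}
  mul_mem' := by
    rintro a b ⟨k, g, hg⟩ ⟨l, h, hh⟩
    obtain ⟨g', hg'⟩ := hg.lift (le_max_left k l)
    obtain ⟨h', hh'⟩ := hh.lift (le_max_right k l)
    refine ⟨max k l, fun z => g' z * h' z, fun p => ⟨(hg' p).1.mul (hh' p).1, ?_⟩⟩
    simp only [Pi.mul_apply, (hg' p).2, (hh' p).2]
  add_mem' := by
    rintro a b ⟨k, g, hg⟩ ⟨l, h, hh⟩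
    obtain ⟨g', hg'⟩ := hg.lift (le_max_left k l)
    obtain ⟨h', hh'⟩ := hh.lift (le_max_right k l)
    refine ⟨max k l, fun z => g' z + h' z, fun p => ⟨(hg' p).1.add (hh' p).1, ?_⟩⟩
    simp only [Pi.add_apply, (hg' p).2, (hh' p).2]
  algebraMap_mem' c := ⟨0, fun _ => c, fun _ => ⟨analyticAt_const, rfl⟩⟩

/-- `b` is the derivative of `a` along the restriction to `S` of the trivial Cartan field: however
`a` is written as a function of finitely many coordinates, differentiating that expression along
the Cartan field gives `b` at the points of `S`. -/
def IsCartanDeriv {n : ℕ} (S : Set (Jet n)) (a b : S → ℝ) : Prop :=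
  ∀ k g, Represents S a k g → ∀ p : S, b p = cartan (fun x => g (trunc k x)) p.1

/-! ### Lie–Bäcklund isomorphisms -/

/-- A map `f = (f₀, f₁, …)` between sets of jets whose components are regular functions of finite
order, and which sends the Cartan field of the source to that of the target. The latter is
expressed on the coordinate functions of the target: the derivative of `f_j` along the Cartan field
of the source is `f_(j+1)`. -/
def IsLieBacklundMap {n q : ℕ} {S : Set (Jet n)} {T : Set (Jet q)} (f : S → T) : Prop :=
  ∀ (j : ℕ) (i : Fin q),
    (fun p => (f p).1 j i) ∈ regularFunctions S ∧
      IsCartanDeriv S (fun p => (f p).1 j i) (fun p => (f p).1 (j + 1) i)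

/-- Flatness on `V` with `m` flat outputs: there are mutually inverse Lie–Bäcklund isomorphisms
between `V` and an open subset `W` of the trivial system `ℝᵐ_∞`. -/
def IsFlatOn {n : ℕ} (m : ℕ) (V : Set (Jet n)) : Prop :=
  ∃ (W : Set (Jet m)) (e : V ≃ W), IsOpen W ∧ IsLieBacklundMap e ∧ IsLieBacklundMap e.symm

/-! ### Implicit systems -/

/-- The expression of a map on the tangent bundle of `X` in the coordinates `(x, ẋ)` given by a
chart `φ`. -/
def coordRep {n r : ℕ} {X : Type*} [TopologicalSpace X] [ChartedSpace (Fin n → ℝ) X]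
    (F : TangentBundle 𝓘(ℝ, Fin n → ℝ) X → Fin r → ℝ)
    (φ : OpenPartialHomeomorph X (Fin n → ℝ)) :
    (Fin n → ℝ) × (Fin n → ℝ) → Fin r → ℝ :=
  fun z => F ⟨φ.symm z.1,
    mfderiv 𝓘(ℝ, Fin n → ℝ) 𝓘(ℝ, Fin n → ℝ) (φ.symm : (Fin n → ℝ) → X) z.1 z.2⟩

/-- A map on the tangent bundle of a real-analytic manifold is meromorphic if in coordinates each
of its components is, near every point, a quotient of two analytic functions, the denominator not
vanishing identically near the point. The values at the zeros of the denominator do not matter. -/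
def IsMeromorphic {n r : ℕ} {X : Type*} [TopologicalSpace X] [ChartedSpace (Fin n → ℝ) X]
    (F : TangentBundle 𝓘(ℝ, Fin n → ℝ) X → Fin r → ℝ) : Prop :=
  ∀ φ ∈ IsManifold.maximalAtlas 𝓘(ℝ, Fin n → ℝ) ω X,
    ∀ z : (Fin n → ℝ) × (Fin n → ℝ), z.1 ∈ φ.target → ∀ i : Fin r,
      ∃ N D : (Fin n → ℝ) × (Fin n → ℝ) → ℝ, AnalyticAt ℝ N z ∧ AnalyticAt ℝ D z ∧
        (¬ ∀ᶠ w in 𝓝 z, D w = 0) ∧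
        ∀ᶠ w in 𝓝 z, D w ≠ 0 → coordRep F φ w i = N w / D w

/-- The zero set `𝔛₀` of the functions `τ^k F`, `k ≥ 0`, over the coordinate domain `Ω`. Only
points at which `F` is regular (has no pole) are considered. -/
def zeroSet {n r : ℕ} (Ω : Set (Fin n → ℝ))
    (F : (Fin n → ℝ) × (Fin n → ℝ) → Fin r → ℝ) : Set (Jet n) :=
  {x | x 0 ∈ Ω ∧ AnalyticAt ℝ F (x 0, x 1) ∧
    ∀ k : ℕ, (cartan^[k] fun y : Jet n => F (y 0, y 1)) x = 0}

/-- The partial derivative of `F_i` at `(x, ẋ)` in the direction `w`, as a regular function on a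
subset of the zero set. -/
def partialF {n r : ℕ} {Ω : Set (Fin n → ℝ)}
    {F : (Fin n → ℝ) × (Fin n → ℝ) → Fin r → ℝ} {V : Set (Jet n)} (hV : V ⊆ zeroSet Ω F)
    (i : Fin r) (w : (Fin n → ℝ) × (Fin n → ℝ)) : regularFunctions V :=
  ⟨fun p => fderiv ℝ F (p.1 0, p.1 1) w i, by
    let L : (Fin (1 + 1) → Fin n → ℝ) →L[ℝ] (Fin n → ℝ) × (Fin n → ℝ) :=
      (ContinuousLinearMap.proj (R := ℝ) (φ := fun _ : Fin (1 + 1) => Fin n → ℝ) 0).prod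
        (ContinuousLinearMap.proj (R := ℝ) (φ := fun _ : Fin (1 + 1) => Fin n → ℝ) 1)
    have hL : ∀ x : Jet n, L (trunc 1 x) = (x 0, x 1) := fun x => rfl
    refine ⟨1, fun z => fderiv ℝ F (L z) w i, fun p => ⟨?_, by simp only [hL]⟩⟩
    have h1 : AnalyticAt ℝ F (L (trunc 1 p.1)) := by rw [hL]; exact (hV p.2).2.1
    have h2 : AnalyticAt ℝ (fun z => fderiv ℝ F (L z)) (trunc 1 p.1) :=
      h1.fderiv.comp (L.analyticAt _)
    let E : ((Fin n → ℝ) × (Fin n → ℝ) →L[ℝ] (Fin r → ℝ)) →L[ℝ] ℝ :=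
      (ContinuousLinearMap.proj (R := ℝ) (φ := fun _ : Fin r => ℝ) i).comp
        (ContinuousLinearMap.apply ℝ (Fin r → ℝ) w)
    exact (E.analyticAt _).comp h2⟩

/-! ### Polynomials in `τ` with coefficients in a differential algebra -/

section TauPolynomials

variable {A : Type*} [CommRing A] [Algebra ℝ A] (δ : Derivation ℝ A A)

/-- Left multiplication by `τ` on the polynomials `∑ b_j τ^j` (with coefficients on the left):
`τ (b τ^j) = b τ^(j+1) + δ(b) τ^j`. -/
def tauEnd : Module.End ℝ A[X] :=
  LinearMap.mulLeft ℝ (X : A[X]) +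
    Polynomial.lsum fun j => ((monomial j : A →ₗ[A] A[X]).restrictScalars ℝ) ∘ₗ δ.toLinearMap

/-- Left multiplication by a coefficient. -/
def coefEnd (a : A) : Module.End ℝ A[X] := LinearMap.mulLeft ℝ (C a)

/-- The noncommutative ring `A[τ]` of polynomials in `τ` with coefficients in `A`, subject to
`τ a = a τ + δ(a)`, realized as the algebra of its own left multiplications. -/
def TauPoly : Subalgebra ℝ (Module.End ℝ A[X]) :=
  Algebra.adjoin ℝ (Set.range (coefEnd (A := A)) ∪ {tauEnd δ})

/-- A coefficient, as an element of `A[τ]`. -/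
def coef (a : A) : TauPoly δ :=
  ⟨coefEnd a, Algebra.subset_adjoin (Or.inl ⟨a, rfl⟩)⟩

/-- The indeterminate `τ` of `A[τ]`. -/
def tau : TauPoly δ := ⟨tauEnd δ, Algebra.subset_adjoin (Or.inr rfl)⟩

theorem tauEnd_monomial (j : ℕ) (b : A) :
    tauEnd δ (monomial j b) = monomial (j + 1) b + monomial j (δ b) := by
  simp [tauEnd, Polynomial.X_mul_monomial, Polynomial.lsum_apply, Polynomial.sum_monomial_index]

/-- The commutation rule of `A[τ]`. -/
theorem tau_mul_coef (a : A) : tau δ * coef δ a = coef δ a * tau δ + coef δ (δ a) := by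
  apply Subtype.ext
  refine LinearMap.ext fun p => ?_
  change tauEnd δ (C a * p) = C a * tauEnd δ p + C (δ a) * p
  induction p using Polynomial.induction_on' with
  | add p q hp hq => rw [mul_add, map_add, hp, hq, map_add]; ring
  | monomial j b =>
    simp only [C_mul_monomial, tauEnd_monomial, mul_add, Derivation.leibniz, smul_eq_mul, map_add]
    rw [mul_comm b (δ a)]
    ring

/-- The element `∑ p_i τ^i` of `A[τ]`. -/
def ofPoly (p : A[X]) : TauPoly δ := p.sum fun i a => coef δ a * tau δ ^ i

/-- Each element of `A[τ]` can be written in one and only one way as `∑ a_i τ^i`. -/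
theorem ofPoly_bijective : Function.Bijective (ofPoly δ) := by
  have hadd : ∀ p q : A[X], ofPoly δ (p + q) = ofPoly δ p + ofPoly δ q := fun p q =>
    Polynomial.sum_add_index p q _
      (fun i => by
        have : coef δ (0 : A) = 0 := Subtype.ext (by simp [coef, coefEnd])
        rw [this, zero_mul])
      (fun i a b => by
        have : coef δ (a + b) = coef δ a + coef δ b :=
          Subtype.ext (LinearMap.ext fun r => by simp [coef, coefEnd, add_mul])
        rw [this, add_mul])
  have hmon : ∀ i (a : A), ofPoly δ (monomial i a) = coef δ a * tau δ ^ i := by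
    intro i a
    have h0 : coef δ (0 : A) = 0 := Subtype.ext (by simp [coef, coefEnd])
    unfold ofPoly
    rw [Polynomial.sum_monomial_index]
    rw [h0, zero_mul]
  have htau1 : ∀ i : ℕ, (tauEnd δ ^ i) (1 : A[X]) = monomial i 1 := by
    intro i
    induction i with
    | zero => simp
    | succ i ih =>
      rw [pow_succ', Module.End.mul_apply, ih, tauEnd_monomial]
      simp
  have hleft : ∀ p : A[X], (ofPoly δ p).1 1 = p := by
    intro p
    induction p using Polynomial.induction_on' with
    | add p q hp hq =>
      rw [hadd]
      change (ofPoly δ p).1 1 + (ofPoly δ q).1 1 = _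
      rw [hp, hq]
    | monomial i a =>
      rw [hmon]
      change C a * (tauEnd δ ^ i) 1 = _
      rw [htau1, C_mul_monomial, mul_one]
  refine ⟨fun p q h => by rw [← hleft p, h, hleft], ?_⟩
  have hcoef : ∀ a p, ∃ q, ofPoly δ q = coef δ a * ofPoly δ p := by
    intro a p
    induction p using Polynomial.induction_on' with
    | add p q hp hq =>
      obtain ⟨u, hu⟩ := hp
      obtain ⟨v, hv⟩ := hq
      exact ⟨u + v, by rw [hadd, hadd, hu, hv, mul_add]⟩
    | monomial i b =>
      refine ⟨monomial i (a * b), ?_⟩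
      rw [hmon, hmon, ← mul_assoc]
      congr 1
      exact Subtype.ext (LinearMap.ext fun r => by simp [coef, coefEnd])
  have htau : ∀ p, ∃ q, ofPoly δ q = tau δ * ofPoly δ p := by
    intro p
    induction p using Polynomial.induction_on' with
    | add p q hp hq =>
      obtain ⟨u, hu⟩ := hp
      obtain ⟨v, hv⟩ := hq
      exact ⟨u + v, by rw [hadd, hadd, hu, hv, mul_add]⟩
    | monomial i b =>
      refine ⟨monomial (i + 1) b + monomial i (δ b), ?_⟩
      rw [hadd, hmon, hmon, hmon, ← mul_assoc, tau_mul_coef, add_mul, pow_succ', mul_assoc]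
  have key : ∀ L : TauPoly δ, ∀ p, ∃ q, ofPoly δ q = L * ofPoly δ p := by
    rintro ⟨L, hL⟩
    induction hL using Algebra.adjoin_induction with
    | mem x hx =>
      rcases hx with ⟨a, rfl⟩ | hx
      · exact hcoef a
      · obtain rfl : x = tauEnd δ := hx
        exact htau
    | algebraMap c =>
      intro p
      obtain ⟨q, hq⟩ := hcoef (algebraMap ℝ A c) p
      refine ⟨q, hq.trans ?_⟩
      congr 1
      refine Subtype.ext (LinearMap.ext fun r => ?_)
      change C (algebraMap ℝ A c) * r = c • r
      rw [← Polynomial.smul_eq_C_mul, algebraMap_smul]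
    | add x y hx hy ihx ihy =>
      intro p
      obtain ⟨u, hu⟩ := ihx p
      obtain ⟨v, hv⟩ := ihy p
      exact ⟨u + v, by rw [hadd, hu, hv, ← add_mul]; rfl⟩
    | mul x y hx hy ihx ihy =>
      intro p
      obtain ⟨v, hv⟩ := ihy p
      obtain ⟨u, hu⟩ := ihx v
      exact ⟨u, by rw [hu, hv, ← mul_assoc]; rfl⟩
  intro L
  obtain ⟨q, hq⟩ := key L 1
  refine ⟨q, hq.trans ?_⟩
  have : ofPoly δ (1 : A[X]) = 1 := by
    have h := hmon 0 1
    rw [monomial_zero_one] at h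
    rw [h, pow_zero, mul_one]
    exact Subtype.ext (LinearMap.ext fun r => by simp [coef, coefEnd])
  rw [this, mul_one]

end TauPolynomials

/-! ### The variational matrix and hyper-regularity -/

/-- The polynomial matrix `P(F) = ∂F/∂x + (∂F/∂ẋ) τ`, with coefficients in `O(V)`. -/
def variationalMatrix {n r : ℕ} {Ω : Set (Fin n → ℝ)}
    {F : (Fin n → ℝ) × (Fin n → ℝ) → Fin r → ℝ} {V : Set (Jet n)} (hV : V ⊆ zeroSet Ω F)
    (δ : Derivation ℝ (regularFunctions V) (regularFunctions V)) :
    Matrix (Fin r) (Fin n) (TauPoly δ) :=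
  Matrix.of fun i j =>
    coef δ (partialF hV i (Pi.single j 1, 0)) + coef δ (partialF hV i (0, Pi.single j 1)) * tau δ

/-- The matrix `[I 0]`. -/
def idZero {R : Type*} [Zero R] [One R] (r n : ℕ) : Matrix (Fin r) (Fin n) R :=
  Matrix.of fun (i : Fin r) (j : Fin n) => if (i : ℕ) = (j : ℕ) then 1 else 0

/-- `P(F)` is hyper-regular on `V`: the Cartan field restricts to a (necessarily unique) derivation
`τ` of `O(V)`, and over the ring `O(V)[τ]` there is a unimodular matrix `U` with `P(F) U = [I 0]`. -/
def IsHyperRegularOn {n r : ℕ} {Ω : Set (Fin n → ℝ)}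
    {F : (Fin n → ℝ) × (Fin n → ℝ) → Fin r → ℝ} {V : Set (Jet n)} (hV : V ⊆ zeroSet Ω F) :
    Prop :=
  ∃ δ : Derivation ℝ (regularFunctions V) (regularFunctions V),
    (∀ a : regularFunctions V, IsCartanDeriv V a.1 (δ a).1) ∧
    ∃ U : Matrix (Fin n) (Fin n) (TauPoly δ), IsUnit U ∧
      variationalMatrix hV δ * U = idZero r n

end FlatSystem

end

/-!
Write `A = O(V)`, `R = A[τ]` and `P = P(F)`. The theorem is the statement that the sequence of left
modules of rows `0 → R^(n-m) → Rⁿ → R^m → 0`, with the maps `s ↦ s P` and `ρ ↦ ρ Q`, is exact and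
split. Here `Q` is the linearization of the parametrization `x = x(y, ẏ, …)` furnished by flatness.
Concretely, `T Q = 1` for the linearization `T` of `y = y(x, ẋ, …)`, and the rows of `1 - Q T` lie in
the kernel of `ρ ↦ ρ Q`, so `1 - Q T = S P` for some `S`; then `P S = 1` because the rows of `P` are
independent, and `[S Q]` is the inverse of the matrix with blocks `P` and `T`
(`exists_isUnit_mul_eq_idZero`).

Everything about `A` is transported from the open set `W` of `ℝᵐ_∞`, where derivatives do not depend
on the expression chosen for a function: `τ` and the `∂/∂y_i^(l)` are derivations of `O(W)`, hence
of `A`. The commutation rule `[∂/∂y^(l), τ] = ∂/∂y^(l-1)` says that the differential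
`a ↦ ∑ ∂a/∂y^(l) τ^l` turns `τ` into left multiplication by `τ` (`flatGrad_cartanDerivation`).
Together with the chain rule (`flatGrad_eq_sum`) this gives `T Q = 1` and, from `F(x, ẋ) = 0`,
`P Q = 0`.

The rows of `P` are independent because `∂F/∂ẋ` has a right inverse over `A`. Exactness in the
middle is where the zero set enters. A row `ρ` with `ρ Q = 0` is a one-form `∑ ρ_(j,i) dx_i^(j)`
vanishing on the velocities of all curves in `V`. Such curves are plentiful (`exists_curve`): the
implicit function theorem gives curves of pairs `(x, ẋ)` in `F = 0`, and since `τ^(k+1) F` is affine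
in `x^(k+2)` with linear part `∂F/∂ẋ`, they lift to jets of infinite order. So the top coefficient
of `ρ` kills the kernel of `∂F/∂ẋ`, which makes it a combination of the rows of `∂F/∂ẋ`;
subtracting a multiple of `P` lowers the degree of `ρ`, and induction shows that `ρ` is a multiple
of `P` (`exists_vecMul_firstOrder_eq`).
-/

noncomputable section

namespace FlatSystem

/-! ### Symbols and degrees in `A[τ]` -/

section TauPolynomials

variable {A : Type*} [CommRing A] [Algebra ℝ A] (δ : Derivation ℝ A A)

theorem coeff_tauEnd_zero (p : A[X]) : (tauEnd δ p).coeff 0 = δ (p.coeff 0) := by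
  induction p using Polynomial.induction_on' with
  | add p q hp hq => simp [hp, hq]
  | monomial j b =>
    rw [tauEnd_monomial]
    by_cases h : j = 0 <;> simp [coeff_monomial, h]

theorem coeff_tauEnd_succ (p : A[X]) (l : ℕ) :
    (tauEnd δ p).coeff (l + 1) = p.coeff l + δ (p.coeff (l + 1)) := by
  induction p using Polynomial.induction_on' with
  | add p q hp hq => simp only [map_add, coeff_add, hp, hq]; ring
  | monomial j b =>
    rw [tauEnd_monomial]
    by_cases h : j = l + 1 <;> simp [coeff_monomial, h]

variable {δ}

theorem coef_zero : coef δ (0 : A) = 0 := Subtype.ext (by simp [coef, coefEnd])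

theorem coef_add (a b : A) : coef δ (a + b) = coef δ a + coef δ b :=
  Subtype.ext (LinearMap.ext fun r => by simp [coef, coefEnd, add_mul])

theorem ofPoly_add (p q : A[X]) : ofPoly δ (p + q) = ofPoly δ p + ofPoly δ q :=
  Polynomial.sum_add_index p q _ (fun i => by rw [coef_zero, zero_mul])
    (fun i a b => by rw [coef_add, add_mul])

theorem ofPoly_monomial (i : ℕ) (a : A) : ofPoly δ (monomial i a) = coef δ a * tau δ ^ i := by
  unfold ofPoly
  rw [Polynomial.sum_monomial_index]
  rw [coef_zero, zero_mul]

theorem tauEnd_pow_one (i : ℕ) : (tauEnd δ ^ i) (1 : A[X]) = monomial i 1 := by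
  induction i with
  | zero => simp
  | succ i ih =>
    rw [pow_succ', Module.End.mul_apply, ih, tauEnd_monomial]
    simp

/-- The commutative polynomial `∑ a_i X^i` attached to the element `∑ a_i τ^i` of `A[τ]`. -/
def symbol (u : TauPoly δ) : A[X] := u.1 1

theorem symbol_mul (u v : TauPoly δ) : symbol (u * v) = u.1 (symbol v) := rfl

theorem symbol_add (u v : TauPoly δ) : symbol (u + v) = symbol u + symbol v := rfl

theorem symbol_sub (u v : TauPoly δ) : symbol (u - v) = symbol u - symbol v := rfl

theorem symbol_zero : symbol (0 : TauPoly δ) = 0 := rfl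

theorem symbol_one : symbol (1 : TauPoly δ) = 1 := rfl

theorem symbol_sum {ι : Type*} (s : Finset ι) (u : ι → TauPoly δ) :
    symbol (∑ i ∈ s, u i) = ∑ i ∈ s, symbol (u i) := by
  classical
  induction s using Finset.induction_on with
  | empty => simp [symbol_zero]
  | insert i s hi ih => rw [Finset.sum_insert hi, Finset.sum_insert hi, symbol_add, ih]

theorem symbol_coef (a : A) : symbol (coef δ a) = C a := by
  change C a * 1 = C a
  rw [mul_one]

theorem symbol_coef_mul (a : A) (u : TauPoly δ) : symbol (coef δ a * u) = C a * symbol u := rfl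

theorem symbol_tau_mul (u : TauPoly δ) : symbol (tau δ * u) = tauEnd δ (symbol u) := rfl

theorem symbol_tau_pow_mul (k : ℕ) (u : TauPoly δ) :
    symbol (tau δ ^ k * u) = (tauEnd δ ^ k) (symbol u) := by
  induction k with
  | zero => simp
  | succ k ih => rw [pow_succ', mul_assoc, symbol_tau_mul, ih, pow_succ', Module.End.mul_apply]

theorem symbol_coef_mul_tau (a : A) : symbol (coef δ a * tau δ) = C a * X := by
  rw [symbol_coef_mul]
  have := tauEnd_pow_one (δ := δ) 1
  rw [pow_one, monomial_one_one_eq_X] at this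
  exact congrArg (C a * ·) this

theorem symbol_ofPoly (p : A[X]) : symbol (ofPoly δ p) = p := by
  induction p using Polynomial.induction_on' with
  | add p q hp hq => rw [ofPoly_add, symbol_add, hp, hq]
  | monomial i a =>
    rw [ofPoly_monomial, symbol_coef_mul, ← mul_one (tau δ ^ i), symbol_tau_pow_mul, symbol_one,
      tauEnd_pow_one, C_mul_monomial, mul_one]

theorem ofPoly_symbol (u : TauPoly δ) : ofPoly δ (symbol u) = u := by
  obtain ⟨p, rfl⟩ := (ofPoly_bijective δ).2 u
  rw [symbol_ofPoly]

theorem symbol_injective : Function.Injective (symbol (δ := δ)) :=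
  Function.LeftInverse.injective ofPoly_symbol

/-- An element of `A[τ]` of degree at most `N`, acting on a polynomial. -/
theorem apply_eq_sum (u : TauPoly δ) {N : ℕ} (hN : (symbol u).natDegree ≤ N) (q : A[X]) :
    u.1 q = ∑ j ∈ Finset.range (N + 1), C ((symbol u).coeff j) * (tauEnd δ ^ j) q := by
  have h : u = ∑ j ∈ Finset.range (N + 1), coef δ ((symbol u).coeff j) * tau δ ^ j := by
    conv_lhs => rw [← ofPoly_symbol u]
    exact Polynomial.sum_over_range' _ (fun j => by rw [coef_zero, zero_mul]) _ (by omega)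
  rw [← symbol_ofPoly (δ := δ) q, ← symbol_mul]
  conv_lhs => rw [h]
  rw [Finset.sum_mul, symbol_sum]
  refine Finset.sum_congr rfl fun j _ => ?_
  rw [mul_assoc, symbol_coef_mul, symbol_tau_pow_mul]

theorem natDegree_tauEnd_pow_le {q : A[X]} {d : ℕ} (hq : q.natDegree ≤ d) (k : ℕ) :
    ((tauEnd δ ^ k) q).natDegree ≤ k + d := by
  induction k with
  | zero => simpa using hq
  | succ k ih =>
    rw [pow_succ', Module.End.mul_apply, natDegree_le_iff_coeff_eq_zero]
    intro l hl
    obtain ⟨l, rfl⟩ : ∃ l', l = l' + 1 := ⟨l - 1, by omega⟩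
    rw [coeff_tauEnd_succ, natDegree_le_iff_coeff_eq_zero.1 ih l (by omega),
      natDegree_le_iff_coeff_eq_zero.1 ih (l + 1) (by omega), map_zero, add_zero]

theorem coeff_tauEnd_pow_top {q : A[X]} {d : ℕ} (hq : q.natDegree ≤ d) (k : ℕ) :
    ((tauEnd δ ^ k) q).coeff (k + d) = q.coeff d := by
  induction k with
  | zero => simp
  | succ k ih =>
    rw [pow_succ', Module.End.mul_apply, show k + 1 + d = k + d + 1 by ring, coeff_tauEnd_succ, ih,
      natDegree_le_iff_coeff_eq_zero.1 (natDegree_tauEnd_pow_le hq k) (k + d + 1) (by omega),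
      map_zero, add_zero]

theorem natDegree_symbol_mul_le {u v : TauPoly δ} {N d : ℕ} (hu : (symbol u).natDegree ≤ N)
    (hv : (symbol v).natDegree ≤ d) : (symbol (u * v)).natDegree ≤ N + d := by
  rw [symbol_mul, apply_eq_sum u hu]
  refine natDegree_sum_le_of_forall_le _ _ fun j hj => ?_
  have := Finset.mem_range.1 hj
  exact (natDegree_C_mul_le _ _).trans ((natDegree_tauEnd_pow_le hv j).trans (by omega))

/-- Top coefficients multiply as in the commutative polynomial ring. -/
theorem coeff_symbol_mul_top {u v : TauPoly δ} {N d : ℕ} (hu : (symbol u).natDegree ≤ N)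
    (hv : (symbol v).natDegree ≤ d) :
    (symbol (u * v)).coeff (N + d) = (symbol u).coeff N * (symbol v).coeff d := by
  rw [symbol_mul, apply_eq_sum u hu, finsetSum_coeff, Finset.sum_range_succ,
    Finset.sum_eq_zero, zero_add, coeff_C_mul, coeff_tauEnd_pow_top hv]
  intro j hj
  have := Finset.mem_range.1 hj
  rw [coeff_C_mul, natDegree_le_iff_coeff_eq_zero.1 (natDegree_tauEnd_pow_le hv j) _ (by omega),
    mul_zero]

/-! ### First-order matrices over `A[τ]` -/

variable (δ) in
/-- The matrix `M₀ + M₁ τ` over `A[τ]`. -/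
def firstOrder {r n : ℕ} (M₀ M₁ : Matrix (Fin r) (Fin n) A) :
    Matrix (Fin r) (Fin n) (TauPoly δ) :=
  Matrix.of fun i j => coef δ (M₀ i j) + coef δ (M₁ i j) * tau δ

section FirstOrder

variable {r n m : ℕ} {M₀ M₁ : Matrix (Fin r) (Fin n) A}

theorem symbol_firstOrder (i : Fin r) (j : Fin n) :
    symbol (firstOrder δ M₀ M₁ i j) = C (M₀ i j) + C (M₁ i j) * X := by
  rw [firstOrder, Matrix.of_apply, symbol_add, symbol_coef, symbol_coef_mul_tau]

theorem natDegree_symbol_firstOrder_le (i : Fin r) (j : Fin n) :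
    (symbol (firstOrder δ M₀ M₁ i j)).natDegree ≤ 1 := by
  rw [symbol_firstOrder]
  compute_degree

theorem coeff_one_symbol_firstOrder (i : Fin r) (j : Fin n) :
    (symbol (firstOrder δ M₀ M₁ i j)).coeff 1 = M₁ i j := by
  rw [symbol_firstOrder]
  simp [coeff_C]

theorem natDegree_symbol_vecMul_firstOrder_le {s : Fin r → TauPoly δ} {N : ℕ}
    (hs : ∀ i, (symbol (s i)).natDegree ≤ N) (j : Fin n) :
    (symbol (Matrix.vecMul s (firstOrder δ M₀ M₁) j)).natDegree ≤ N + 1 := by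
  rw [Matrix.vecMul, dotProduct, symbol_sum]
  exact natDegree_sum_le_of_forall_le _ _ fun i _ =>
    natDegree_symbol_mul_le (hs i) (natDegree_symbol_firstOrder_le i j)

theorem coeff_symbol_vecMul_firstOrder {s : Fin r → TauPoly δ} {N : ℕ}
    (hs : ∀ i, (symbol (s i)).natDegree ≤ N) (j : Fin n) :
    (symbol (Matrix.vecMul s (firstOrder δ M₀ M₁) j)).coeff (N + 1) =
      Matrix.vecMul (fun i => (symbol (s i)).coeff N) M₁ j := by
  rw [Matrix.vecMul, dotProduct, symbol_sum, finsetSum_coeff, Matrix.vecMul, dotProduct]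
  refine Finset.sum_congr rfl fun i _ => ?_
  rw [coeff_symbol_mul_top (hs i) (natDegree_symbol_firstOrder_le i j),
    coeff_one_symbol_firstOrder]

theorem exists_natDegree_symbol_le {ι : Type*} [Fintype ι] (s : ι → TauPoly δ) :
    ∃ N, ∀ i, (symbol (s i)).natDegree ≤ N :=
  ⟨Finset.univ.sup fun i => (symbol (s i)).natDegree, fun i =>
    Finset.le_sup (f := fun i => (symbol (s i)).natDegree) (Finset.mem_univ i)⟩

/-- The rows of `M₀ + M₁ τ` are left linearly independent when `M₁` has a right inverse. -/
theorem eq_zero_of_vecMul_firstOrder_eq_zero {B : Matrix (Fin n) (Fin r) A} (hB : M₁ * B = 1)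
    {s : Fin r → TauPoly δ} (hs : Matrix.vecMul s (firstOrder δ M₀ M₁) = 0) : s = 0 := by
  obtain ⟨N, hN⟩ := exists_natDegree_symbol_le s
  have top : ∀ N, (∀ i, (symbol (s i)).natDegree ≤ N) → ∀ i, (symbol (s i)).coeff N = 0 := by
    intro N hN i
    have h1 : Matrix.vecMul (fun i => (symbol (s i)).coeff N) M₁ = 0 := by
      funext j
      rw [← coeff_symbol_vecMul_firstOrder (M₀ := M₀) hN j, hs]
      simp [symbol_zero]
    have h2 := congrArg (fun v => Matrix.vecMul v B) h1
    simp only [Matrix.vecMul_vecMul, hB, Matrix.vecMul_one, Matrix.zero_vecMul] at h2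
    exact congrFun h2 i
  induction N with
  | zero =>
    funext i
    apply symbol_injective
    rw [eq_C_of_natDegree_le_zero (hN i), top 0 hN i, C_0]
    rfl
  | succ N ih =>
    refine ih fun i => ?_
    rw [natDegree_le_iff_coeff_eq_zero]
    intro l hl
    rcases Nat.lt_or_ge (N + 1) l with h | h
    · exact natDegree_le_iff_coeff_eq_zero.1 (hN i) l h
    · obtain rfl : l = N + 1 := by omega
      exact top _ hN i

/-- Division by `M₀ + M₁ τ`: a set of rows stable under subtraction of left multiples of
`M₀ + M₁ τ`, whose members of positive degree have top coefficient in the row space of `M₁` and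
whose only member of degree zero is `0`, consists of left multiples. Here the set is the left
kernel of `Q`. -/
theorem exists_vecMul_firstOrder_eq {B : Matrix (Fin n) (Fin r) A}
    {Q : Matrix (Fin n) (Fin m) (TauPoly δ)} (hPQ : firstOrder δ M₀ M₁ * Q = 0)
    (hzero : ∀ ρ : Fin n → TauPoly δ, Matrix.vecMul ρ Q = 0 →
      (∀ i, (symbol (ρ i)).natDegree ≤ 0) → ρ = 0)
    (htop : ∀ (N : ℕ) (ρ : Fin n → TauPoly δ), Matrix.vecMul ρ Q = 0 →
      (∀ i, (symbol (ρ i)).natDegree ≤ N + 1) →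
      Matrix.vecMul (fun i => (symbol (ρ i)).coeff (N + 1)) (B * M₁) =
        fun i => (symbol (ρ i)).coeff (N + 1))
    (ρ : Fin n → TauPoly δ) (hρ : Matrix.vecMul ρ Q = 0) :
    ∃ s, Matrix.vecMul s (firstOrder δ M₀ M₁) = ρ := by
  obtain ⟨N, hN⟩ := exists_natDegree_symbol_le ρ
  induction N generalizing ρ with
  | zero => exact ⟨0, by rw [Matrix.zero_vecMul, hzero ρ hρ hN]⟩
  | succ N ih =>
    set c : Fin n → A := fun i => (symbol (ρ i)).coeff (N + 1)
    let s : Fin r → TauPoly δ := fun i => ofPoly δ (monomial N (Matrix.vecMul c B i))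
    have hs : ∀ i, (symbol (s i)).natDegree ≤ N := fun i => by
      simp only [s, symbol_ofPoly]
      exact natDegree_monomial_le _
    have hs' : (fun i => (symbol (s i)).coeff N) = Matrix.vecMul c B := by
      funext i
      simp only [s, symbol_ofPoly, coeff_monomial_same]
    have hdeg : ∀ i, (symbol ((ρ - Matrix.vecMul s (firstOrder δ M₀ M₁)) i)).natDegree ≤ N := by
      intro i
      rw [natDegree_le_iff_coeff_eq_zero]
      intro l hl
      rw [Pi.sub_apply, symbol_sub, coeff_sub]
      rcases Nat.lt_or_ge (N + 1) l with h | h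
      · rw [natDegree_le_iff_coeff_eq_zero.1 (hN i) l h, natDegree_le_iff_coeff_eq_zero.1
          (natDegree_symbol_vecMul_firstOrder_le hs i) l h, sub_zero]
      · obtain rfl : l = N + 1 := by omega
        rw [coeff_symbol_vecMul_firstOrder hs, hs', Matrix.vecMul_vecMul, htop N ρ hρ hN, sub_self]
    have hker : Matrix.vecMul (ρ - Matrix.vecMul s (firstOrder δ M₀ M₁)) Q = 0 := by
      refine (Matrix.sub_vecMul Q ρ _).trans ?_
      rw [hρ, Matrix.vecMul_vecMul, hPQ, Matrix.vecMul_zero]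
      exact sub_zero (0 : Fin m → TauPoly δ)
    obtain ⟨s', hs'⟩ := ih _ hker hdeg
    exact ⟨s' + s, by rw [Matrix.add_vecMul, hs']; exact sub_add_cancel ρ _⟩

end FirstOrder

end TauPolynomials

/-! ### Completion of a split exact sequence to a unimodular matrix -/

/-- If `0 → Rʳ → Rⁿ → Rᵐ → 0` (rows, acted on from the right by `P` and then `Q`) is exact and `T`
splits `Q`, then `P` is the top block of a unimodular matrix with bottom block `T`. -/
theorem exists_isUnit_mul_eq_idZero {R : Type*} [Ring R] {r m n : ℕ} (hn : r + m = n)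
    {P : Matrix (Fin r) (Fin n) R} {Q : Matrix (Fin n) (Fin m) R} {T : Matrix (Fin m) (Fin n) R}
    (hPQ : P * Q = 0) (hTQ : T * Q = 1)
    (hinj : ∀ s : Fin r → R, Matrix.vecMul s P = 0 → s = 0)
    (hexact : ∀ ρ : Fin n → R, Matrix.vecMul ρ Q = 0 → ∃ s, Matrix.vecMul s P = ρ) :
    ∃ U : Matrix (Fin n) (Fin n) R, IsUnit U ∧ P * U = idZero r n := by
  have hinj' : ∀ {k : ℕ} (S : Matrix (Fin k) (Fin r) R), S * P = 0 → S = 0 := by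
    intro k S hS
    ext i j
    exact congrFun (hinj (S i) (by rw [← Matrix.mul_apply_eq_vecMul, hS]; rfl)) j
  have hrow : ∀ i, ∃ s, Matrix.vecMul s P = (1 - Q * T : Matrix (Fin n) (Fin n) R) i := fun i => hexact _ (by
    rw [← Matrix.mul_apply_eq_vecMul, Matrix.sub_mul, Matrix.one_mul, Matrix.mul_assoc, hTQ,
      Matrix.mul_one, sub_self]
    rfl)
  choose s hs using hrow
  set S : Matrix (Fin n) (Fin r) R := Matrix.of s
  have hSP : S * P = 1 - Q * T := by
    ext i j
    rw [Matrix.mul_apply_eq_vecMul, ← hs i]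
    rfl
  have hPS : P * S = 1 := by
    rw [← sub_eq_zero]
    refine hinj' _ ?_
    rw [Matrix.sub_mul, Matrix.mul_assoc, hSP, Matrix.mul_sub, ← Matrix.mul_assoc, hPQ,
      Matrix.mul_one, Matrix.one_mul, Matrix.zero_mul, sub_zero, sub_self]
  have hTS : T * S = 0 := by
    refine hinj' _ ?_
    rw [Matrix.mul_assoc, hSP, Matrix.mul_sub, ← Matrix.mul_assoc, hTQ, Matrix.mul_one,
      Matrix.one_mul, sub_self]
  let ε : Fin n ≃ Fin r ⊕ Fin m := ((finCongr hn.symm).trans finSumFinEquiv.symm)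
  let U : Matrix (Fin n) (Fin n) R := (Matrix.fromCols S Q).submatrix id ε
  let U' : Matrix (Fin n) (Fin n) R := (Matrix.fromRows P T).submatrix ε id
  have h1 : U * U' = 1 := by
    rw [Matrix.submatrix_mul_equiv, Matrix.fromCols_mul_fromRows, hSP, sub_add_cancel]
    exact Matrix.submatrix_id_id _
  have h2 : U' * U = 1 := by
    change Matrix.submatrix _ _ (Equiv.refl _) * Matrix.submatrix _ (Equiv.refl _) _ = 1
    rw [Matrix.submatrix_mul_equiv, Matrix.fromRows_mul_fromCols, hPS, hPQ, hTS, hTQ,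
      Matrix.fromBlocks_one, Matrix.submatrix_one_equiv]
  refine ⟨U, ⟨⟨U, U', h1, h2⟩, rfl⟩, ?_⟩
  have h3 : P * U = (Matrix.fromCols (1 : Matrix (Fin r) (Fin r) R) 0).submatrix id ε := by
    change P.submatrix id (Equiv.refl _) * Matrix.submatrix _ (Equiv.refl _) _ = _
    rw [Matrix.submatrix_mul_equiv, Matrix.mul_fromCols, hPS, hPQ]
  rw [h3]
  ext i j
  obtain ⟨x, rfl⟩ := ε.symm.surjective j
  rw [Matrix.submatrix_apply, Equiv.apply_symm_apply]
  rcases x with x | x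
  · simp [idZero, ε, Matrix.one_apply, Fin.ext_iff]
  · have : (i : ℕ) ≠ r + x := by omega
    simp [idZero, ε, this]

/-- The criterion for `M₀ + M₁ τ` to be hyper-regular: a matrix `Q` with a left inverse whose left
kernel consists of multiples of `M₀ + M₁ τ`. -/
theorem exists_isUnit_firstOrder_mul {A : Type*} [CommRing A] [Algebra ℝ A]
    {δ : Derivation ℝ A A} {r n m : ℕ} (hn : r + m = n) {M₀ M₁ : Matrix (Fin r) (Fin n) A}
    {B : Matrix (Fin n) (Fin r) A} (hB : M₁ * B = 1) {Q : Matrix (Fin n) (Fin m) (TauPoly δ)}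
    (hPQ : firstOrder δ M₀ M₁ * Q = 0) (hQ : ∃ T : Matrix (Fin m) (Fin n) (TauPoly δ), T * Q = 1)
    (hzero : ∀ ρ : Fin n → TauPoly δ, Matrix.vecMul ρ Q = 0 →
      (∀ i, (symbol (ρ i)).natDegree ≤ 0) → ρ = 0)
    (htop : ∀ (N : ℕ) (ρ : Fin n → TauPoly δ), Matrix.vecMul ρ Q = 0 →
      (∀ i, (symbol (ρ i)).natDegree ≤ N + 1) →
      Matrix.vecMul (fun i => (symbol (ρ i)).coeff (N + 1)) (B * M₁) =
        fun i => (symbol (ρ i)).coeff (N + 1)) :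
    ∃ U : Matrix (Fin n) (Fin n) (TauPoly δ), IsUnit U ∧ firstOrder δ M₀ M₁ * U = idZero r n := by
  obtain ⟨T, hT⟩ := hQ
  -- unification alone would search for the ring structure by unfolding `A[τ]`
  exact @exists_isUnit_mul_eq_idZero (TauPoly δ) (TauPoly δ).toRing r m n hn _ _ _ hPQ hT
    (fun _ => eq_zero_of_vecMul_firstOrder_eq_zero hB) (exists_vecMul_firstOrder_eq hPQ hzero htop)

/-! ### Differentiation of regular functions along curves of jets -/

theorem analyticAt_clm_apply {E F G : Type*} [NormedAddCommGroup E] [NormedSpace ℝ E]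
    [NormedAddCommGroup F] [NormedSpace ℝ F] [NormedAddCommGroup G] [NormedSpace ℝ G]
    {c : E → F →L[ℝ] G} {v : E → F} {x : E} (hc : AnalyticAt ℝ c x) (hv : AnalyticAt ℝ v x) :
    AnalyticAt ℝ (fun y => c y (v y)) x :=
  AnalyticAt.comp (f := fun y => (c y, v y)) (x := x)
    ((ContinuousLinearMap.id ℝ (F →L[ℝ] G)).analyticAt_bilinear (c x, v x)) (hc.prod hv)

section RegularFunctions

variable {n m : ℕ}

theorem continuous_line (x v : Jet n) : Continuous fun t : ℝ => x + t • v := by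
  fun_prop

theorem cartan_comp_trunc {G : Type*} [NormedAddCommGroup G] [NormedSpace ℝ G] {k : ℕ}
    {g : (Fin (k + 1) → Fin n → ℝ) → G} {x : Jet n} (hg : AnalyticAt ℝ g (trunc k x)) :
    cartan (fun y => g (trunc k y)) x = fderiv ℝ g (trunc k x) (trunc k (shift x)) := by
  have h : HasLineDerivAt ℝ g (fderiv ℝ g (trunc k x) (trunc k (shift x))) (trunc k x)
      (trunc k (shift x)) := hg.differentiableAt.hasFDerivAt.hasLineDerivAt _
  exact h.lineDeriv

theorem extend_apply {S : Set (Jet n)} (a : S → ℝ) {x : Jet n} (hx : x ∈ S) :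
    Function.extend Subtype.val a 0 x = a ⟨x, hx⟩ :=
  Subtype.val_injective.extend_apply a 0 ⟨x, hx⟩

/-- The chain rule along a curve in `S`, for the extension of a regular function by zero. The curve
only has to be differentiable coordinate by coordinate. -/
theorem Represents.hasDerivAt_curve {S : Set (Jet n)} {a : S → ℝ} {k : ℕ}
    {g : (Fin (k + 1) → Fin n → ℝ) → ℝ} (h : Represents S a k g) {x : ℝ → Jet n} {ξ : Jet n}
    {t₀ : ℝ} (hx : ∀ᶠ t in 𝓝 t₀, x t ∈ S) (hd : ∀ j, HasDerivAt (fun t => x t j) (ξ j) t₀) :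
    HasDerivAt (fun t => Function.extend Subtype.val a 0 (x t))
      (fderiv ℝ g (trunc k (x t₀)) (trunc k ξ)) t₀ := by
  have h0 : x t₀ ∈ S := hx.self_of_nhds
  have hg := (h ⟨x t₀, h0⟩).1.differentiableAt.hasFDerivAt
  have hc : HasDerivAt (fun t => trunc k (x t)) (trunc k ξ) t₀ :=
    hasDerivAt_pi.2 fun j => hd j
  refine (hg.comp_hasDerivAt t₀ hc).congr_of_eventuallyEq ?_
  filter_upwards [hx] with t ht
  rw [extend_apply a ht, (h ⟨x t, ht⟩).2]
  rfl

/-- The derivative of a function on `S`, extended by zero, in the direction `η`. -/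
def dirDeriv {S : Set (Jet n)} (a : S → ℝ) (x η : Jet n) : ℝ :=
  lineDeriv ℝ (Function.extend Subtype.val a 0) x η

theorem eventually_line_mem {S : Set (Jet n)} (hS : IsOpen S) {x : Jet n} (hx : x ∈ S)
    (η : Jet n) : ∀ᶠ t : ℝ in 𝓝 0, x + t • η ∈ S :=
  (continuous_line x η).continuousAt.eventually (by simpa using hS.mem_nhds hx)

theorem hasDerivAt_line (x η : Jet n) (j : ℕ) :
    HasDerivAt (fun t : ℝ => (x + t • η) j) (η j) 0 := by
  simpa using (((hasDerivAt_id (0 : ℝ)).smul_const (η j)).const_add (x j))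

theorem Represents.hasDerivAt_line {S : Set (Jet n)} (hS : IsOpen S) {a : S → ℝ} {k : ℕ}
    {g : (Fin (k + 1) → Fin n → ℝ) → ℝ} (h : Represents S a k g) {x : Jet n} (hx : x ∈ S)
    (η : Jet n) :
    HasDerivAt (fun t : ℝ => Function.extend Subtype.val a 0 (x + t • η))
      (fderiv ℝ g (trunc k x) (trunc k η)) 0 := by
  have := h.hasDerivAt_curve (eventually_line_mem hS hx η) (FlatSystem.hasDerivAt_line x η)
  simpa using this

theorem Represents.dirDeriv_eq {S : Set (Jet n)} (hS : IsOpen S) {a : S → ℝ} {k : ℕ}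
    {g : (Fin (k + 1) → Fin n → ℝ) → ℝ} (h : Represents S a k g) {x : Jet n} (hx : x ∈ S)
    (η : Jet n) : dirDeriv a x η = fderiv ℝ g (trunc k x) (trunc k η) :=
  (h.hasDerivAt_line hS hx η).deriv

theorem hasDerivAt_dirDeriv {S : Set (Jet n)} (hS : IsOpen S) {a : S → ℝ}
    (ha : a ∈ regularFunctions S) {x : Jet n} (hx : x ∈ S) (η : Jet n) :
    HasDerivAt (fun t : ℝ => Function.extend Subtype.val a 0 (x + t • η)) (dirDeriv a x η) 0 := by
  obtain ⟨k, g, h⟩ := ha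
  rw [h.dirDeriv_eq hS hx]
  exact h.hasDerivAt_line hS hx η

/-! ### Operations on regular functions -/

theorem Represents.partial {S : Set (Jet n)} {a : S → ℝ} {k : ℕ}
    {g : (Fin (k + 1) → Fin n → ℝ) → ℝ} (h : Represents S a k g) (v : Fin (k + 1) → Fin n → ℝ) :
    Represents S (fun p => fderiv ℝ g (trunc k p.1) v) k (fun z => fderiv ℝ g z v) := fun p =>
  ⟨((ContinuousLinearMap.apply ℝ ℝ v).analyticAt _).comp (h p).1.fderiv, rfl⟩

/-- The coordinate `x_i^(j)` as a regular function. -/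
def coord (S : Set (Jet n)) (j : ℕ) (i : Fin n) : regularFunctions S :=
  ⟨fun p => p.1 j i, j, fun z => z (Fin.last j) i, fun _ =>
    ⟨((ContinuousLinearMap.proj (R := ℝ) (φ := fun _ : Fin n => ℝ) i).comp
      (ContinuousLinearMap.proj (R := ℝ) (φ := fun _ : Fin (j + 1) => Fin n → ℝ)
        (Fin.last j))).analyticAt _, rfl⟩⟩

/-- The unit vector in the direction of the coordinate `x_i^(j)`. -/
def unitJet (j : ℕ) (i : Fin n) : Jet n := Pi.single j (Pi.single i 1)

theorem apply_eq_sum_single {k : ℕ} {G : Type*} [AddCommGroup G] [Module ℝ G]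
    (L : (Fin (k + 1) → Fin n → ℝ) →ₗ[ℝ] G) (v : Fin (k + 1) → Fin n → ℝ) :
    L v = ∑ j, ∑ i, v j i • L (Pi.single j (Pi.single i 1)) := by
  conv_lhs => rw [← Finset.univ_sum_single v]
  rw [map_sum]
  refine Finset.sum_congr rfl fun j _ => ?_
  have h : (Pi.single j (v j) : Fin (k + 1) → Fin n → ℝ) =
      ∑ i, v j i • Pi.single j (Pi.single i 1) := by
    conv_lhs => rw [pi_eq_sum_univ' (v j)]
    ext j' i'
    rcases eq_or_ne j' j with rfl | h
    · simp
    · simp [h]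
  rw [h, map_sum]
  simp only [map_smul]

theorem trunc_unitJet (k : ℕ) (j : Fin (k + 1)) (i : Fin n) :
    trunc k (unitJet (j : ℕ) i) = Pi.single j (Pi.single i 1) := by
  ext j' i'
  rcases eq_or_ne j' j with rfl | h
  · simp [trunc, unitJet]
  · have h' : (j' : ℕ) ≠ j := fun h' => h (Fin.ext h')
    simp [trunc, unitJet, h, h']

theorem trunc_unitJet_of_lt {k l : ℕ} (h : k < l) (i : Fin n) : trunc k (unitJet l i) = 0 := by
  ext j i'
  have h' : (j : ℕ) ≠ l := by omega
  simp [trunc, unitJet, h']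

/-- Derivatives of regular functions along a vector field with regular components are regular. -/
theorem dirDeriv_mem {S : Set (Jet n)} (hS : IsOpen S) {a : S → ℝ} (ha : a ∈ regularFunctions S)
    {ξ : Jet n → Jet n} (hξ : ∀ j i, (fun p : S => ξ p.1 j i) ∈ regularFunctions S) :
    (fun p : S => dirDeriv a p.1 (ξ p.1)) ∈ regularFunctions S := by
  obtain ⟨k, g, h⟩ := ha
  have heq : (fun p : S => dirDeriv a p.1 (ξ p.1)) = ∑ j : Fin (k + 1), ∑ i : Fin n,
      (fun p : S => ξ p.1 j i) *
        fun p : S => fderiv ℝ g (trunc k p.1) (Pi.single j (Pi.single i 1)) := by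
    funext p
    rw [h.dirDeriv_eq hS p.2]
    refine (apply_eq_sum_single (fderiv ℝ g (trunc k p.1)).toLinearMap _).trans ?_
    simp only [Finset.sum_apply, Pi.mul_apply]
    rfl
  rw [heq]
  exact Subalgebra.sum_mem _ fun j _ => Subalgebra.sum_mem _ fun i _ =>
    Subalgebra.mul_mem _ (hξ j i) ⟨k, _, h.partial _⟩

/-- The derivation of `O(S)`, `S` open, given by a vector field with regular components. -/
def fieldDerivation {S : Set (Jet n)} (hS : IsOpen S) (ξ : Jet n → Jet n)
    (hξ : ∀ j i, (fun p : S => ξ p.1 j i) ∈ regularFunctions S) :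
    Derivation ℝ (regularFunctions S) (regularFunctions S) :=
  Derivation.mk'
    { toFun := fun a => ⟨fun p : S => dirDeriv a.1 p.1 (ξ p.1), dirDeriv_mem hS a.2 hξ⟩
      map_add' := fun a b => Subtype.ext <| funext fun p => by
        refine HasDerivAt.deriv (((hasDerivAt_dirDeriv hS a.2 p.2 _).add
          (hasDerivAt_dirDeriv hS b.2 p.2 _)).congr_of_eventuallyEq ?_)
        filter_upwards [eventually_line_mem hS p.2 (ξ p.1)] with t ht
        simp only [Pi.add_apply, extend_apply _ ht]
        rfl
      map_smul' := fun c a => Subtype.ext <| funext fun p => by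
        refine HasDerivAt.deriv (((hasDerivAt_dirDeriv hS a.2 p.2 _).const_smul
          c).congr_of_eventuallyEq ?_)
        filter_upwards [eventually_line_mem hS p.2 (ξ p.1)] with t ht
        simp only [Pi.smul_apply, extend_apply _ ht]
        rfl }
    fun a b => Subtype.ext <| funext fun p => by
      have h0 : p.1 + (0 : ℝ) • ξ p.1 = p.1 := by rw [zero_smul, add_zero]
      have h := (hasDerivAt_dirDeriv hS a.2 p.2 (ξ p.1)).mul
        (hasDerivAt_dirDeriv hS b.2 p.2 (ξ p.1))
      rw [h0, extend_apply _ p.2, extend_apply _ p.2] at h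
      refine (HasDerivAt.deriv (h.congr_of_eventuallyEq ?_)).trans ?_
      · filter_upwards [eventually_line_mem hS p.2 (ξ p.1)] with t ht
        simp only [Pi.mul_apply, extend_apply _ ht]
        rfl
      · change dirDeriv a.1 p.1 _ * b.1 p + a.1 p * dirDeriv b.1 p.1 _ =
          a.1 p * dirDeriv b.1 p.1 _ + b.1 p * dirDeriv a.1 p.1 _
        ring

/-- The derivative in a constant direction. -/
def constDerivation {S : Set (Jet n)} (hS : IsOpen S) (η : Jet n) :
    Derivation ℝ (regularFunctions S) (regularFunctions S) :=
  fieldDerivation hS (fun _ => η) fun j i => ⟨0, fun _ => η j i, fun _ => ⟨analyticAt_const, rfl⟩⟩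

/-- The Cartan field as a derivation of `O(S)`, `S` open. -/
def shiftDerivation {S : Set (Jet n)} (hS : IsOpen S) :
    Derivation ℝ (regularFunctions S) (regularFunctions S) :=
  fieldDerivation hS shift fun j i => (coord S (j + 1) i).2

/-- The commutation rule of the Cartan field with constant fields: `[∂_η, τ] = ∂_(shift η)`. In
coordinates this says `[∂/∂y^(l), τ] = ∂/∂y^(l-1)`. -/
theorem constDerivation_shiftDerivation {S : Set (Jet n)} (hS : IsOpen S) (η : Jet n)
    (a : regularFunctions S) :
    constDerivation hS η (shiftDerivation hS a) =
      constDerivation hS (shift η) a + shiftDerivation hS (constDerivation hS η a) := by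
  obtain ⟨a, k, g, h⟩ := a
  let L₀ : (Fin (k + 1 + 1) → Fin n → ℝ) →L[ℝ] (Fin (k + 1) → Fin n → ℝ) :=
    ContinuousLinearMap.pi fun j =>
      ContinuousLinearMap.proj (R := ℝ) (φ := fun _ : Fin (k + 1 + 1) => Fin n → ℝ) j.castSucc
  let L₁ : (Fin (k + 1 + 1) → Fin n → ℝ) →L[ℝ] (Fin (k + 1) → Fin n → ℝ) :=
    ContinuousLinearMap.pi fun j =>
      ContinuousLinearMap.proj (R := ℝ) (φ := fun _ : Fin (k + 1 + 1) => Fin n → ℝ) j.succ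
  have hL₀ : ∀ x : Jet n, L₀ (trunc (k + 1) x) = trunc k x := fun x => rfl
  have hL₁ : ∀ x : Jet n, L₁ (trunc (k + 1) x) = trunc k (shift x) := fun x => rfl
  have hτ : Represents S (fun p => dirDeriv a p.1 (shift p.1)) (k + 1)
      fun z => fderiv ℝ g (L₀ z) (L₁ z) := fun p => by
    refine ⟨?_, h.dirDeriv_eq hS p.2 _⟩
    have h1 : AnalyticAt ℝ g (L₀ (trunc (k + 1) p.1)) := by rw [hL₀]; exact (h p).1
    exact analyticAt_clm_apply (h1.fderiv.comp (L₀.analyticAt _)) (L₁.analyticAt _)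
  have hη : Represents S (fun p => dirDeriv a p.1 η) k fun z => fderiv ℝ g z (trunc k η) :=
    fun p => ⟨(h.partial (trunc k η) p).1, h.dirDeriv_eq hS p.2 η⟩
  refine Subtype.ext <| funext fun p => ?_
  change dirDeriv _ p.1 η = dirDeriv a p.1 (shift η) + dirDeriv _ p.1 (shift p.1)
  refine (hτ.dirDeriv_eq hS p.2 η).trans ?_
  have e3 := hη.dirDeriv_eq hS p.2 (shift p.1)
  have hg2 : HasFDerivAt (fderiv ℝ g) (fderiv ℝ (fderiv ℝ g) (trunc k p.1)) (trunc k p.1) :=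
    (h p).1.fderiv.differentiableAt.hasFDerivAt
  have hsymm := ((h p).1.contDiffAt (n := ω)).isSymmSndFDerivAt (by simp)
  have d1 : HasFDerivAt (fun z => fderiv ℝ g z (trunc k η))
      ((fderiv ℝ (fderiv ℝ g) (trunc k p.1)).flip (trunc k η)) (trunc k p.1) := by
    simpa using hg2.clm_apply (hasFDerivAt_const (trunc k η) (trunc k p.1))
  have d2 : HasFDerivAt (fun z => fderiv ℝ g (L₀ z) (L₁ z))
      ((fderiv ℝ g (trunc k p.1)).comp L₁ +
        ((fderiv ℝ (fderiv ℝ g) (trunc k p.1)).comp L₀).flip (trunc k (shift p.1)))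
      (trunc (k + 1) p.1) := by
    have h0 : HasFDerivAt (fun z => fderiv ℝ g (L₀ z))
        ((fderiv ℝ (fderiv ℝ g) (trunc k p.1)).comp L₀) (trunc (k + 1) p.1) :=
      HasFDerivAt.comp (f := L₀) (trunc (k + 1) p.1) (by rw [hL₀]; exact hg2) L₀.hasFDerivAt
    have := h0.clm_apply (L₁.hasFDerivAt (x := trunc (k + 1) p.1))
    rwa [hL₀, hL₁] at this
  rw [h.dirDeriv_eq hS p.2]
  refine Eq.trans ?_ (congrArg _ e3.symm)
  rw [d1.fderiv, d2.fderiv]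
  change fderiv ℝ g _ (L₁ _) + fderiv ℝ (fderiv ℝ g) _ (L₀ _) _ = _ +
    fderiv ℝ (fderiv ℝ g) _ (trunc k (shift p.1)) (trunc k η)
  rw [hL₀, hL₁, hsymm]

/-- Composition with a map between sets of jets that has regular components. -/
def pullback {S : Set (Jet n)} {T : Set (Jet m)} (f : S → T)
    (hf : ∀ j i, (fun p => (f p).1 j i) ∈ regularFunctions S) :
    regularFunctions T →ₐ[ℝ] regularFunctions S where
  toFun a := ⟨fun p => a.1 (f p), by
    obtain ⟨a, k, g, h⟩ := a
    choose κ G hG using hf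
    let K : ℕ := Finset.univ.sup fun ji : Fin (k + 1) × Fin m => κ ji.1 ji.2
    have hK : ∀ (j : Fin (k + 1)) (i : Fin m), κ j i ≤ K := fun j i =>
      Finset.le_sup (f := fun ji : Fin (k + 1) × Fin m => κ ji.1 ji.2) (Finset.mem_univ (j, i))
    choose G' hG' using fun (j : Fin (k + 1)) (i : Fin m) => (hG j i).lift (hK j i)
    refine ⟨K, fun z => g fun j i => G' j i z, fun p => ?_⟩
    have heq : (fun (j : Fin (k + 1)) i => G' j i (trunc K p.1)) = trunc k (f p).1 := by
      funext j i
      exact ((hG' j i p).2).symm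
    refine ⟨?_, (h (f p)).2.trans (congrArg g heq.symm)⟩
    have h1 : AnalyticAt ℝ g ((fun z (j : Fin (k + 1)) i => G' j i z) (trunc K p.1)) := by
      change AnalyticAt ℝ g fun j i => G' j i (trunc K p.1)
      rw [heq]
      exact (h (f p)).1
    exact h1.comp (AnalyticAt.pi fun j => AnalyticAt.pi fun i => (hG' j i p).1)⟩
  map_one' := rfl
  map_mul' _ _ := rfl
  map_zero' := rfl
  map_add' _ _ := rfl
  commutes' _ := rfl

end RegularFunctions

/-! ### Derivations transported along a Lie–Bäcklund isomorphism -/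

section Transport

variable {n m : ℕ} {V : Set (Jet n)} {W : Set (Jet m)} {e : V ≃ W}

/-- The derivation of `O(V)` corresponding to a derivation of `O(W)`. -/
def transport (he : IsLieBacklundMap e) (he' : IsLieBacklundMap e.symm)
    (D : Derivation ℝ (regularFunctions W) (regularFunctions W)) :
    Derivation ℝ (regularFunctions V) (regularFunctions V) :=
  Derivation.mk'
    ((pullback e fun j i => (he j i).1).toLinearMap ∘ₗ D.toLinearMap ∘ₗ
      (pullback e.symm fun j i => (he' j i).1).toLinearMap)
    fun a b => by
      have h : ∀ a : regularFunctions V, pullback e (fun j i => (he j i).1)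
          (pullback e.symm (fun j i => (he' j i).1) a) = a := fun a =>
        Subtype.ext <| funext fun p => congrArg a.1 (e.symm_apply_apply p)
      simp only [LinearMap.comp_apply, AlgHom.toLinearMap_apply, map_mul, Derivation.leibniz,
        Derivation.coeFn_coe, map_add, smul_eq_mul, h]

variable (hW : IsOpen W) (he : IsLieBacklundMap e) (he' : IsLieBacklundMap e.symm)

theorem transport_transport (D D' : Derivation ℝ (regularFunctions W) (regularFunctions W))
    (a : regularFunctions V) :
    transport he he' D (transport he he' D' a) = pullback e (fun j i => (he j i).1)
      (D (D' (pullback e.symm (fun j i => (he' j i).1) a))) := by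
  have h : ∀ a : regularFunctions W, pullback e.symm (fun j i => (he' j i).1)
      (pullback e (fun j i => (he j i).1) a) = a := fun a =>
    Subtype.ext <| funext fun p => congrArg a.1 (e.apply_symm_apply p)
  exact congrArg (fun b => pullback e (fun j i => (he j i).1) (D b)) (h _)

/-- The chain rule for the derivation of `O(V)` defined by a vector field on `W`. -/
theorem transport_fieldDerivation_apply (ξ : Jet m → Jet m)
    (hξ : ∀ j i, (fun p : W => ξ p.1 j i) ∈ regularFunctions W) {a : regularFunctions V} {k : ℕ}
    {g : (Fin (k + 1) → Fin n → ℝ) → ℝ} (h : Represents V a.1 k g) (p : V) :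
    (transport he he' (fieldDerivation hW ξ hξ) a).1 p = fderiv ℝ g (trunc k p.1)
      (trunc k fun j i => (transport he he' (fieldDerivation hW ξ hξ) (coord V j i)).1 p) := by
  set w : W := e p
  set η := ξ w.1
  have hmem := eventually_line_mem hW w.2 η
  let back := pullback e.symm fun j i => (he' j i).1
  let x : ℝ → Jet n := fun t j i =>
    Function.extend Subtype.val (back (coord V j i)).1 0 (w.1 + t • η)
  have hx : ∀ t (ht : w.1 + t • η ∈ W), x t = (e.symm ⟨w.1 + t • η, ht⟩).1 := by
    intro t ht
    funext j i
    exact extend_apply _ ht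
  have hx0 : x 0 = p.1 := by
    have h0 : w.1 + (0 : ℝ) • η = w.1 := by rw [zero_smul, add_zero]
    rw [hx 0 (by rw [h0]; exact w.2)]
    have : (⟨w.1 + (0 : ℝ) • η, by rw [h0]; exact w.2⟩ : W) = e p := Subtype.ext h0
    rw [this, e.symm_apply_apply]
  have hxV : ∀ᶠ t in 𝓝 0, x t ∈ V := by
    filter_upwards [hmem] with t ht
    rw [hx t ht]
    exact (e.symm _).2
  have hd := h.hasDerivAt_curve hxV fun j => hasDerivAt_pi.2 fun i =>
    hasDerivAt_dirDeriv hW (back (coord V j i)).2 w.2 η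
  rw [hx0] at hd
  refine HasDerivAt.unique (hasDerivAt_dirDeriv hW (back a).2 w.2 η)
    (hd.congr_of_eventuallyEq ?_)
  filter_upwards [hmem] with t ht
  rw [extend_apply _ ht, hx t ht, extend_apply _ (e.symm _).2]
  rfl

/-- The Cartan field as a derivation of `O(V)`. -/
def cartanDerivation : Derivation ℝ (regularFunctions V) (regularFunctions V) :=
  transport he he' (shiftDerivation hW)

/-- The derivation `∂/∂y_i^(l)` of `O(V)`, where `y, ẏ, …` are the coordinates of `W`. -/
def flatDerivation (l : ℕ) (i : Fin m) :
    Derivation ℝ (regularFunctions V) (regularFunctions V) :=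
  transport he he' (constDerivation hW (unitJet l i))

theorem cartanDerivation_coord (j : ℕ) (i : Fin n) :
    cartanDerivation hW he he' (coord V j i) = coord V (j + 1) i := by
  refine Subtype.ext <| funext fun p => ?_
  obtain ⟨⟨k, g, h⟩, hc⟩ := he' j i
  have h1 := hc k g h (e p)
  rw [cartan_comp_trunc (h (e p)).1] at h1
  refine (h.dirDeriv_eq hW (e p).2 _).trans (h1.symm.trans ?_)
  simp only [e.symm_apply_apply]
  rfl

theorem isCartanDeriv_cartanDerivation (a : regularFunctions V) :
    IsCartanDeriv V a.1 (cartanDerivation hW he he' a).1 := by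
  intro k g h p
  rw [cartan_comp_trunc (h p).1]
  refine (transport_fieldDerivation_apply hW he he' _ _ h p).trans ?_
  congr 2
  funext j i
  exact congrFun (congrArg Subtype.val (cartanDerivation_coord hW he he' j i)) p

theorem flatDerivation_zero_cartanDerivation (i : Fin m) (a : regularFunctions V) :
    flatDerivation hW he he' 0 i (cartanDerivation hW he he' a) =
      cartanDerivation hW he he' (flatDerivation hW he he' 0 i a) := by
  have h : shift (unitJet 0 i) = 0 := by
    funext j
    simp [shift, unitJet]
  rw [flatDerivation, cartanDerivation, transport_transport, transport_transport,
    constDerivation_shiftDerivation, h]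
  refine congrArg _ ?_
  rw [add_eq_right]
  obtain ⟨k, g, hg⟩ := (pullback e.symm (fun j i => (he' j i).1) a).2
  refine Subtype.ext <| funext fun p => ?_
  refine (hg.dirDeriv_eq hW p.2 0).trans ?_
  exact map_zero _

theorem flatDerivation_succ_cartanDerivation (l : ℕ) (i : Fin m) (a : regularFunctions V) :
    flatDerivation hW he he' (l + 1) i (cartanDerivation hW he he' a) =
      flatDerivation hW he he' l i a +
        cartanDerivation hW he he' (flatDerivation hW he he' (l + 1) i a) := by
  have h : shift (unitJet (l + 1) i) = unitJet l i := by
    funext j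
    simp only [shift, unitJet, Pi.single_apply, add_left_inj]
  rw [flatDerivation, cartanDerivation, transport_transport, transport_transport,
    constDerivation_shiftDerivation, h, map_add]
  rfl

theorem exists_forall_lt_flatDerivation_eq_zero (a : regularFunctions V) :
    ∃ k, ∀ l > k, ∀ i, flatDerivation hW he he' l i a = 0 := by
  obtain ⟨k, g, hg⟩ := (pullback e.symm (fun j i => (he' j i).1) a).2
  refine ⟨k, fun l hl i => Subtype.ext <| funext fun p => ?_⟩
  refine (hg.dirDeriv_eq hW (e p).2 _).trans ?_
  rw [trunc_unitJet_of_lt hl, map_zero]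
  rfl

theorem flatDerivation_pullback_coord (l j : ℕ) (i i' : Fin m) :
    flatDerivation hW he he' l i (pullback e (fun j i => (he j i).1) (coord W j i')) =
      if j = l ∧ i' = i then 1 else 0 := by
  refine Subtype.ext <| funext fun p => ?_
  have hb : (pullback e.symm (fun j i => (he' j i).1)
      (pullback e (fun j i => (he j i).1) (coord W j i'))) = coord W j i' :=
    Subtype.ext <| funext fun p => congrArg (fun q : W => q.1 j i') (e.apply_symm_apply p)
  change dirDeriv (pullback e.symm (fun j i => (he' j i).1)
      (pullback e (fun j i => (he j i).1) (coord W j i'))).1 (e p).1 (unitJet l i) = _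
  rw [hb]
  have h1 : Represents W (coord W j i').1 j fun z => z (Fin.last j) i' := fun _ =>
    ⟨((ContinuousLinearMap.proj (R := ℝ) (φ := fun _ : Fin m => ℝ) i').comp
      (ContinuousLinearMap.proj (R := ℝ) (φ := fun _ : Fin (j + 1) => Fin m → ℝ)
        (Fin.last j))).analyticAt _, rfl⟩
  have h2 := hasDerivAt_pi.1 (hasDerivAt_line (e p).1 (unitJet l i) j) i'
  have h3 : HasDerivAt (fun t : ℝ => Function.extend Subtype.val (coord W j i').1 0
      ((e p).1 + t • unitJet l i)) (unitJet l i j i') 0 := by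
    refine h2.congr_of_eventuallyEq ?_
    filter_upwards [eventually_line_mem hW (e p).2 (unitJet l i)] with t ht
    rw [extend_apply _ ht]
    rfl
  refine h3.deriv.trans ?_
  by_cases hj : j = l
  · subst hj
    by_cases hi : i' = i <;> simp [unitJet, hi]
  · simp [unitJet, hj]

/-! ### The gradient with respect to the flat coordinates -/

theorem exists_coeff_eq_flatDerivation (i : Fin m) (a : regularFunctions V) :
    ∃ p : (regularFunctions V)[X], ∀ l, p.coeff l = flatDerivation hW he he' l i a := by
  obtain ⟨k, hk⟩ := exists_forall_lt_flatDerivation_eq_zero hW he he' a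
  refine ⟨∑ l ∈ Finset.range (k + 1), monomial l (flatDerivation hW he he' l i a), fun l => ?_⟩
  simp only [finsetSum_coeff, coeff_monomial, Finset.sum_ite_eq', Finset.mem_range]
  split_ifs with h
  · rfl
  · exact (hk l (by omega) i).symm

/-- The `i`-th part `∑ ∂a/∂y_i^(l) τ^l` of the differential of `a` in the flat coordinates, as a
polynomial. -/
def flatGrad (i : Fin m) (a : regularFunctions V) : (regularFunctions V)[X] :=
  (exists_coeff_eq_flatDerivation hW he he' i a).choose

theorem coeff_flatGrad (i : Fin m) (a : regularFunctions V) (l : ℕ) :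
    (flatGrad hW he he' i a).coeff l = flatDerivation hW he he' l i a :=
  (exists_coeff_eq_flatDerivation hW he he' i a).choose_spec l

/-- The differential of `τ a` is `τ` times the differential of `a`. -/
theorem flatGrad_cartanDerivation (i : Fin m) (a : regularFunctions V) :
    flatGrad hW he he' i (cartanDerivation hW he he' a) =
      tauEnd (cartanDerivation hW he he') (flatGrad hW he he' i a) := by
  ext1 l
  cases l with
  | zero => rw [coeff_tauEnd_zero, coeff_flatGrad, coeff_flatGrad,
      flatDerivation_zero_cartanDerivation]
  | succ l => rw [coeff_tauEnd_succ, coeff_flatGrad, coeff_flatGrad, coeff_flatGrad,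
      flatDerivation_succ_cartanDerivation]

theorem tauEnd_pow_flatGrad_coord (i : Fin m) (i' : Fin n) (j : ℕ) :
    (tauEnd (cartanDerivation hW he he') ^ j) (flatGrad hW he he' i (coord V 0 i')) =
      flatGrad hW he he' i (coord V j i') := by
  induction j with
  | zero => rfl
  | succ j ih =>
    rw [pow_succ', Module.End.mul_apply, ih, ← flatGrad_cartanDerivation, cartanDerivation_coord]

/-- The chain rule: the differential of `g(x, ẋ, …, x^(k))` is `∑ ∂g/∂x_i^(j) dx_i^(j)`. -/
theorem flatGrad_eq_sum {a : regularFunctions V} {k : ℕ} {g : (Fin (k + 1) → Fin n → ℝ) → ℝ}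
    (h : Represents V a.1 k g) (i : Fin m) :
    flatGrad hW he he' i a = ∑ j : Fin (k + 1), ∑ i' : Fin n,
      C (⟨_, k, _, h.partial (Pi.single j (Pi.single i' 1))⟩ : regularFunctions V) *
        flatGrad hW he he' i (coord V j i') := by
  ext1 l
  simp only [finsetSum_coeff, coeff_C_mul, coeff_flatGrad]
  refine Subtype.ext <| funext fun p => ?_
  refine (transport_fieldDerivation_apply hW he he' _ _ h p).trans ?_
  refine (apply_eq_sum_single (fderiv ℝ g (trunc k p.1)).toLinearMap _).trans ?_
  simp only [AddSubmonoidClass.coe_finsetSum, Finset.sum_apply, MulMemClass.coe_mul, Pi.mul_apply]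
  refine Finset.sum_congr rfl fun j _ => Finset.sum_congr rfl fun i' _ => ?_
  exact mul_comm _ _

/-- A function whose differential in the flat coordinates vanishes at `p` is stationary along every
curve of `V` through `p`. -/
theorem hasDerivAt_zero_of_flatDerivation_eq_zero {a : regularFunctions V} {x : ℝ → Jet n}
    {ξ : Jet n} (hx : ∀ᶠ t in 𝓝 0, x t ∈ V) (hd : ∀ j, HasDerivAt (fun t => x t j) (ξ j) 0)
    (ha : ∀ l i, (flatDerivation hW he he' l i a).1 ⟨x 0, hx.self_of_nhds⟩ = 0) :
    HasDerivAt (fun t => Function.extend Subtype.val a.1 0 (x t)) 0 0 := by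
  set p : V := ⟨x 0, hx.self_of_nhds⟩
  let back := pullback e.symm fun j i => (he' j i).1
  obtain ⟨k, g, hg⟩ := (back a).2
  choose κ G hG using fun j i => (he j i).1
  let w : ℝ → Jet m := fun t j i => Function.extend Subtype.val (fun q : V => (e q).1 j i) 0 (x t)
  have hw : ∀ t (ht : x t ∈ V), w t = (e ⟨x t, ht⟩).1 := by
    intro t ht
    funext j i
    exact extend_apply _ ht
  have hwW : ∀ᶠ t in 𝓝 0, w t ∈ W := by
    filter_upwards [hx] with t ht
    rw [hw t ht]
    exact (e _).2
  have h1 := hg.hasDerivAt_curve hwW fun j => hasDerivAt_pi.2 fun i =>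
    (hG j i).hasDerivAt_curve hx hd
  have h2 : ∀ η : Jet m, fderiv ℝ g (trunc k (w 0)) (trunc k η) = 0 := by
    intro η
    refine (apply_eq_sum_single (fderiv ℝ g (trunc k (w 0))).toLinearMap _).trans ?_
    refine Finset.sum_eq_zero fun l _ => Finset.sum_eq_zero fun i _ => ?_
    have h3 := ha l i
    have h4 : (flatDerivation hW he he' l i a).1 p = fderiv ℝ g (trunc k (w 0))
        (trunc k (unitJet (l : ℕ) i)) := by
      rw [hw 0 p.2]
      exact hg.dirDeriv_eq hW (e p).2 _
    rw [h4, trunc_unitJet] at h3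
    refine (congrArg _ h3).trans (smul_zero _)
  rw [h2] at h1
  refine h1.congr_of_eventuallyEq ?_
  filter_upwards [hx] with t ht
  rw [extend_apply _ ht, hw t ht, extend_apply _ (e _).2]
  exact congrArg a.1 (e.symm_apply_apply _).symm

end Transport

/-! ### Curves in the zero set -/

section Curves

variable {n r : ℕ}

theorem cartan_congr {G : Type*} [NormedAddCommGroup G] [NormedSpace ℝ G] {a b : Jet n → G}
    {x : Jet n} (h : a =ᶠ[𝓝 x] b) : cartan a x = cartan b x := by
  refine Filter.EventuallyEq.deriv_eq ?_
  have hc := (continuous_line x (shift x)).tendsto 0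
  rw [zero_smul, add_zero] at hc
  exact hc.eventually h

/-- On the points where `F` is analytic, `τ^(k+1) F` is affine in the highest derivative
`x^(k+2)`, with linear part `∂F/∂ẋ`. -/
theorem iterate_cartan_eq (F : (Fin n → ℝ) × (Fin n → ℝ) → Fin r → ℝ) (k : ℕ) :
    ∃ h : (Fin (k + 1 + 1) → Fin n → ℝ) → Fin r → ℝ, ∀ x : Jet n, AnalyticAt ℝ F (x 0, x 1) →
      AnalyticAt ℝ h (trunc (k + 1) x) ∧ (cartan^[k + 1] fun y : Jet n => F (y 0, y 1)) x =
        fderiv ℝ F (x 0, x 1) (0, x (k + 2)) + h (trunc (k + 1) x) := by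
  induction k with
  | zero =>
    let P : (Fin (1 + 1) → Fin n → ℝ) →L[ℝ] (Fin n → ℝ) × (Fin n → ℝ) :=
      (ContinuousLinearMap.proj (R := ℝ) (φ := fun _ : Fin (1 + 1) => Fin n → ℝ) 0).prod
        (ContinuousLinearMap.proj (R := ℝ) (φ := fun _ : Fin (1 + 1) => Fin n → ℝ) 1)
    have hP : ∀ x : Jet n, P (trunc 1 x) = (x 0, x 1) := fun x => rfl
    let Q : (Fin (1 + 1) → Fin n → ℝ) →L[ℝ] (Fin n → ℝ) × (Fin n → ℝ) :=
      (ContinuousLinearMap.proj (R := ℝ) (φ := fun _ : Fin (1 + 1) => Fin n → ℝ) 1).prod 0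
    refine ⟨fun z => fderiv ℝ F (P z) (Q z), fun x hx => ?_⟩
    have h1 : AnalyticAt ℝ F (P (trunc 1 x)) := hx
    refine ⟨analyticAt_clm_apply (h1.fderiv.comp (P.analyticAt _)) (Q.analyticAt _), ?_⟩
    refine (cartan_comp_trunc (g := fun z => F (P z)) (h1.comp (P.analyticAt _))).trans ?_
    have h2 : HasFDerivAt (fun z => F (P z)) ((fderiv ℝ F (P (trunc 1 x))).comp P) (trunc 1 x) :=
      h1.differentiableAt.hasFDerivAt.comp _ P.hasFDerivAt
    rw [h2.fderiv]
    change fderiv ℝ F (x 0, x 1) (x 1, x 2) =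
      fderiv ℝ F (x 0, x 1) (0, x 2) + fderiv ℝ F (x 0, x 1) (x 1, 0)
    rw [← map_add]
    simp
  | succ k ih =>
    obtain ⟨h, hh⟩ := ih
    let pr : Fin (k + 2 + 1) → (Fin (k + 2 + 1) → Fin n → ℝ) →L[ℝ] (Fin n → ℝ) := fun j =>
      ContinuousLinearMap.proj (R := ℝ) (φ := fun _ : Fin (k + 2 + 1) => Fin n → ℝ) j
    let P : (Fin (k + 2 + 1) → Fin n → ℝ) →L[ℝ] (Fin n → ℝ) × (Fin n → ℝ) :=
      (pr ⟨0, by omega⟩).prod (pr ⟨1, by omega⟩)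
    let P' : (Fin (k + 2 + 1) → Fin n → ℝ) →L[ℝ] (Fin n → ℝ) × (Fin n → ℝ) :=
      (pr ⟨1, by omega⟩).prod (pr ⟨2, by omega⟩)
    let T : (Fin (k + 2 + 1) → Fin n → ℝ) →L[ℝ] (Fin n → ℝ) × (Fin n → ℝ) :=
      (0 : (Fin (k + 2 + 1) → Fin n → ℝ) →L[ℝ] (Fin n → ℝ)).prod (pr ⟨k + 2, by omega⟩)
    let L₀ : (Fin (k + 2 + 1) → Fin n → ℝ) →L[ℝ] (Fin (k + 1 + 1) → Fin n → ℝ) :=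
      ContinuousLinearMap.pi fun j => pr j.castSucc
    let L₁ : (Fin (k + 2 + 1) → Fin n → ℝ) →L[ℝ] (Fin (k + 1 + 1) → Fin n → ℝ) :=
      ContinuousLinearMap.pi fun j => pr j.succ
    refine ⟨fun z => fderiv ℝ (fderiv ℝ F) (P z) (P' z) (T z) + fderiv ℝ h (L₀ z) (L₁ z),
      fun x hx => ?_⟩
    have hF : AnalyticAt ℝ F (P (trunc (k + 2) x)) := hx
    have ha : AnalyticAt ℝ h (L₀ (trunc (k + 2) x)) := (hh x hx).1
    refine ⟨(analyticAt_clm_apply (analyticAt_clm_apply (hF.fderiv.fderiv.comp (P.analyticAt _))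
      (P'.analyticAt _)) (T.analyticAt _)).add (analyticAt_clm_apply
        (ha.fderiv.comp (L₀.analyticAt _)) (L₁.analyticAt _)), ?_⟩
    have hnear : (cartan^[k + 1] fun y : Jet n => F (y 0, y 1)) =ᶠ[𝓝 x] fun y =>
        (fun z => fderiv ℝ F (P z) (T z) + h (L₀ z)) (trunc (k + 2) y) := by
      have hc : Continuous fun y : Jet n => (y 0, y 1) := by fun_prop
      filter_upwards [hc.continuousAt.eventually hx.eventually_analyticAt] with y hy
      exact (hh y hy).2
    have hG : AnalyticAt ℝ (fun z => fderiv ℝ F (P z) (T z) + h (L₀ z)) (trunc (k + 2) x) :=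
      (analyticAt_clm_apply (hF.fderiv.comp (P.analyticAt _)) (T.analyticAt _)).add
        (ha.comp (L₀.analyticAt _))
    rw [Function.iterate_succ_apply', cartan_congr hnear, cartan_comp_trunc hG]
    have d0 : HasFDerivAt (fun z => fderiv ℝ F (P z))
        ((fderiv ℝ (fderiv ℝ F) (P (trunc (k + 2) x))).comp P) (trunc (k + 2) x) :=
      hF.fderiv.differentiableAt.hasFDerivAt.comp _ P.hasFDerivAt
    have d1 : HasFDerivAt (fun z => h (L₀ z)) ((fderiv ℝ h (L₀ (trunc (k + 2) x))).comp L₀)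
        (trunc (k + 2) x) :=
      ha.differentiableAt.hasFDerivAt.comp _ L₀.hasFDerivAt
    have d2 := (d0.clm_apply (T.hasFDerivAt (x := trunc (k + 2) x))).add d1
    refine (congrArg (fun L => L (trunc (k + 2) (shift x))) d2.fderiv).trans ?_
    exact add_assoc _ _ _

theorem exists_seq_of_prefix {α : Type*} [Inhabited α] (Ψ : ℕ → (ℕ → α) → α)
    (hΨ : ∀ k u v, (∀ j < k, u j = v j) → Ψ k u = Ψ k v) : ∃ x : ℕ → α, ∀ k, x k = Ψ k x := by
  let step : ∀ k : ℕ, (∀ j : ℕ, j < k → α) → α := fun k ih =>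
    Ψ k fun j => if h : j < k then ih j h else default
  refine ⟨Nat.lt_wfRel.wf.fix step, fun k => ?_⟩
  rw [WellFounded.fix_eq]
  exact hΨ k _ _ fun j hj => dif_pos hj

/-- A curve of first-order jets in the zero set of `F` lifts to a curve of infinite jets in `V`: the
equations `τ^(k+1) F = 0` are solved one after the other for `x^(k+2)`, starting from the guess
`x^(k+2)(0) + t v_(k+2)` and correcting it with a right inverse of `∂F/∂ẋ`. As long as the
curve is constant in the lower orders and `v_(k+2)` is in the kernel of `∂F/∂ẋ`, the guess solves
the equation and is not changed. -/
theorem exists_lift {Ω : Set (Fin n → ℝ)} (hΩ : IsOpen Ω)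
    {F : (Fin n → ℝ) × (Fin n → ℝ) → Fin r → ℝ} {O : Set (Jet n)} (hO : IsOpen O) {p : Jet n}
    (hpO : p ∈ O) (hp : p ∈ zeroSet Ω F)
    (hsurj : Function.Surjective fun v : Fin n → ℝ => fderiv ℝ F (p 0, p 1) (0, v))
    {c : ℝ → (Fin n → ℝ) × (Fin n → ℝ)} (hc0 : c 0 = (p 0, p 1)) (hc : DifferentiableAt ℝ c 0)
    (hFc : ∀ᶠ t in 𝓝 0, F (c t) = 0) (v : Jet n) :
    ∃ x : ℝ → Jet n, x 0 = p ∧ (∀ᶠ t in 𝓝 0, x t ∈ O ∩ zeroSet Ω F) ∧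
      (∀ j, DifferentiableAt ℝ (fun t => x t j) 0) ∧ (∀ t, (x t 0, x t 1) = c t) ∧
      ∀ t k, (∀ j ≤ k + 1, x t j = p j) → fderiv ℝ F (p 0, p 1) (0, v (k + 2)) = 0 →
        x t (k + 2) = p (k + 2) + t • v (k + 2) := by
  obtain ⟨hpΩ, hpF, hp0⟩ := hp
  choose h hh using iterate_cartan_eq F
  let M : (Fin n → ℝ) × (Fin n → ℝ) → (Fin n → ℝ) →L[ℝ] (Fin r → ℝ) := fun z =>
    (fderiv ℝ F z).comp (ContinuousLinearMap.inr ℝ (Fin n → ℝ) (Fin n → ℝ))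
  have hM : ∀ z u, M z u = fderiv ℝ F z (0, u) := fun z u => rfl
  obtain ⟨B₀, hB₀⟩ := (M (p 0, p 1)).exists_rightInverse_of_surjective
    (LinearMap.range_eq_top.2 hsurj)
  let B : ℝ → (Fin r → ℝ) →L[ℝ] (Fin n → ℝ) := fun t =>
    B₀.comp (Ring.inverse ((M (c t)).comp B₀))
  have hMd : DifferentiableAt ℝ (fun t => M (c t)) 0 := by
    have h1 : DifferentiableAt ℝ (fderiv ℝ F) (c 0) := by
      rw [hc0]; exact hpF.fderiv.differentiableAt
    exact (h1.comp 0 hc).clm_comp (differentiableAt_const _)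
  have hMB : DifferentiableAt ℝ (fun t => (M (c t)).comp B₀) 0 :=
    hMd.clm_comp (differentiableAt_const _)
  have hMB0 : (M (c 0)).comp B₀ = 1 := by rw [hc0]; exact hB₀
  have hBd : DifferentiableAt ℝ B 0 := by
    refine (differentiableAt_const _).clm_comp ?_
    have h1 : DifferentiableAt ℝ
        (Ring.inverse : ((Fin r → ℝ) →L[ℝ] (Fin r → ℝ)) → _) ((M (c 0)).comp B₀) :=
      differentiableAt_inverse (by rw [hMB0]; exact isUnit_one)
    exact h1.comp 0 hMB
  have hunit : ∀ᶠ t in 𝓝 0, IsUnit ((M (c t)).comp B₀) := by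
    refine hMB.continuousAt.eventually (Units.isOpen.mem_nhds ?_)
    change IsUnit ((M (c 0)).comp B₀)
    rw [hMB0]
    exact isUnit_one
  let q : ℝ → Jet n := fun t => p + t • v
  let Ψ : ℝ → ℕ → Jet n → Fin n → ℝ := fun t k u =>
    match k with
    | 0 => (c t).1
    | 1 => (c t).2
    | k + 2 => q t (k + 2) - B t (M (c t) (q t (k + 2)) + h k (trunc (k + 1) u))
  have hΨ : ∀ t k (u u' : Jet n), (∀ j < k, u j = u' j) → Ψ t k u = Ψ t k u' := by
    intro t k u u' huu
    match k with
    | 0 => rfl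
    | 1 => rfl
    | k + 2 =>
      have : trunc (k + 1) u = trunc (k + 1) u' := funext fun j => huu j j.2
      simp only [Ψ, this]
  choose x hx using fun t => exists_seq_of_prefix (Ψ t) (hΨ t)
  have hxc : ∀ t, (x t 0, x t 1) = c t := fun t => Prod.ext (hx t 0) (hx t 1)
  have hx2 : ∀ t k, x t (k + 2) =
      q t (k + 2) - B t (M (c t) (q t (k + 2)) + h k (trunc (k + 1) (x t))) :=
    fun t k => hx t (k + 2)
  have hguess : ∀ t k, (∀ j ≤ k + 1, x t j = p j) → fderiv ℝ F (p 0, p 1) (0, v (k + 2)) = 0 →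
      x t (k + 2) = p (k + 2) + t • v (k + 2) := by
    intro t k hj hv
    have h1 : c t = (p 0, p 1) := by rw [← hxc, hj 0 (by omega), hj 1 (by omega)]
    have h2 : trunc (k + 1) (x t) = trunc (k + 1) p := funext fun j => hj j (by omega)
    have h3 : M (p 0, p 1) (q t (k + 2)) + h k (trunc (k + 1) p) = 0 := by
      have h4 : q t (k + 2) = p (k + 2) + t • v (k + 2) := rfl
      rw [h4, map_add, map_smul, hM, hM, hv, smul_zero, add_zero, ← (hh k p hpF).2]
      exact hp0 (k + 1)
    rw [hx2, h1, h2, h3, map_zero, sub_zero]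
    rfl
  have hxp : x 0 = p := by
    funext j
    induction j using Nat.strong_induction_on with
    | _ j ih =>
      match j with
      | 0 => exact (hx 0 0).trans (by simp only [Ψ, hc0])
      | 1 => exact (hx 0 1).trans (by simp only [Ψ, hc0])
      | k + 2 =>
        have h2 : trunc (k + 1) (x 0) = trunc (k + 1) p := funext fun j => ih j (by omega)
        have h4 : q 0 (k + 2) = p (k + 2) := by simp [q]
        rw [hx2, h2, h4, hc0, hM, ← (hh k p hpF).2, hp0 (k + 1)]
        simp
  have hxd : ∀ j, DifferentiableAt ℝ (fun t => x t j) 0 := by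
    intro j
    induction j using Nat.strong_induction_on with
    | _ j ih =>
      match j with
      | 0 => simpa only [hx, Ψ] using hc.fst
      | 1 => simpa only [hx, Ψ] using hc.snd
      | k + 2 =>
        have hq : DifferentiableAt ℝ (fun t => q t (k + 2)) 0 :=
          (hasDerivAt_line p v (k + 2)).differentiableAt
        have htr : DifferentiableAt ℝ (fun t => trunc (k + 1) (x t)) 0 :=
          differentiableAt_pi.2 fun j => ih j (by omega)
        have hhd : DifferentiableAt ℝ (h k) (trunc (k + 1) (x 0)) := by
          rw [hxp]; exact (hh k p hpF).1.differentiableAt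
        simp only [hx2]
        exact hq.sub (hBd.clm_apply ((hMd.clm_apply hq).add (hhd.comp 0 htr)))
  refine ⟨x, hxp, ?_, hxd, hxc, hguess⟩
  have hcont : ContinuousAt x 0 := continuousAt_pi.2 fun j => (hxd j).continuousAt
  have hmemO : ∀ᶠ t in 𝓝 0, x t ∈ O := hcont.eventually (hO.mem_nhds (by rwa [hxp]))
  have hΩ' : ∀ᶠ t in 𝓝 0, (c t).1 ∈ Ω :=
    hc.fst.continuousAt.eventually (hΩ.mem_nhds (by beta_reduce; rwa [hc0]))
  have hF' : ∀ᶠ t in 𝓝 0, AnalyticAt ℝ F (c t) :=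
    hc.continuousAt.eventually (by rw [hc0]; exact hpF.eventually_analyticAt)
  filter_upwards [hmemO, hΩ', hF', hunit, hFc] with t h1 h2 h3 h4 h5
  refine ⟨h1, by rw [← hxc] at h2; exact h2, by rw [hxc]; exact h3, fun k => ?_⟩
  match k with
  | 0 => exact (congrArg F (hxc t)).trans h5
  | k + 1 =>
    have hB : ∀ u, M (c t) (B t u) = u := fun u =>
      congrArg (fun L : (Fin r → ℝ) →L[ℝ] (Fin r → ℝ) => L u) (Ring.mul_inverse_cancel _ h4)
    rw [(hh k (x t) (by rw [hxc]; exact h3)).2, hxc, ← hM, hx2, map_sub, hB]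
    abel

/-- The implicit function theorem in the form needed here: a vector in the kernel of a surjective
derivative is tangent to a curve in the zero set. -/
theorem exists_curve_of_mem_ker {F : (Fin n → ℝ) × (Fin n → ℝ) → Fin r → ℝ}
    {z : (Fin n → ℝ) × (Fin n → ℝ)} (hF : AnalyticAt ℝ F z) (hz : F z = 0)
    (hsurj : Function.Surjective (fderiv ℝ F z)) {ξ : (Fin n → ℝ) × (Fin n → ℝ)}
    (hξ : fderiv ℝ F z ξ = 0) :
    ∃ c : ℝ → (Fin n → ℝ) × (Fin n → ℝ), c 0 = z ∧ HasDerivAt c ξ 0 ∧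
      ∀ᶠ t in 𝓝 0, F (c t) = 0 := by
  have hs : HasStrictFDerivAt F (fderiv ℝ F z) z := hF.hasStrictFDerivAt
  have hr : (fderiv ℝ F z).range = ⊤ := LinearMap.range_eq_top.2 hsurj
  let ξ' : (fderiv ℝ F z).ker := ⟨ξ, hξ⟩
  have hline : HasDerivAt (fun t : ℝ => t • ξ') ξ' 0 := by
    simpa using (hasDerivAt_id (0 : ℝ)).smul_const ξ'
  refine ⟨fun t => hs.implicitFunction F _ hr (F z) (t • ξ'), ?_, ?_, ?_⟩
  · beta_reduce
    rw [zero_smul]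
    exact hs.implicitFunction_apply_image hr
  · have h1 : HasFDerivAt (hs.implicitFunction F _ hr (F z)) (fderiv ℝ F z).ker.subtypeL
        ((0 : ℝ) • ξ') := by
      rw [zero_smul]
      exact (hs.to_implicitFunction hr).hasFDerivAt
    exact h1.comp_hasDerivAt 0 hline
  · have h1 := hs.map_implicitFunction_eq hr
    have h2 : Tendsto (fun t : ℝ => (F z, t • ξ')) (𝓝 0) (𝓝 (F z, 0)) := by
      have : Continuous fun t : ℝ => (F z, t • ξ') := by fun_prop
      simpa using this.tendsto 0
    filter_upwards [h2.eventually h1] with t ht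
    exact ht.trans hz

/-- Through each point of `V` there are curves in `V` whose velocity has a prescribed first nonzero
entry `x^(N)`: any vector if `N = 0`, any vector in the kernel of `∂F/∂ẋ` if `N > 0`. -/
theorem exists_curve {Ω : Set (Fin n → ℝ)} (hΩ : IsOpen Ω)
    {F : (Fin n → ℝ) × (Fin n → ℝ) → Fin r → ℝ} {O : Set (Jet n)} (hO : IsOpen O) {p : Jet n}
    (hpO : p ∈ O) (hp : p ∈ zeroSet Ω F)
    (hsurj : Function.Surjective fun v : Fin n → ℝ => fderiv ℝ F (p 0, p 1) (0, v)) (N : ℕ)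
    (v : Fin n → ℝ) (hv : 0 < N → fderiv ℝ F (p 0, p 1) (0, v) = 0) :
    ∃ (x : ℝ → Jet n) (ξ : Jet n), x 0 = p ∧ (∀ᶠ t in 𝓝 0, x t ∈ O ∩ zeroSet Ω F) ∧
      (∀ j, HasDerivAt (fun t => x t j) (ξ j) 0) ∧ (∀ j < N, ξ j = 0) ∧ ξ N = v := by
  have hp0 : F (p 0, p 1) = 0 := hp.2.2 0
  have hsurj' : Function.Surjective (fderiv ℝ F (p 0, p 1)) := fun u =>
    let ⟨w, hw⟩ := hsurj u
    ⟨(0, w), hw⟩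
  match N with
  | 0 =>
    obtain ⟨w, hw⟩ := hsurj (-fderiv ℝ F (p 0, p 1) (v, 0))
    have hker : fderiv ℝ F (p 0, p 1) (v, w) = 0 := by
      have : ((v, w) : (Fin n → ℝ) × (Fin n → ℝ)) = (v, 0) + (0, w) := by simp
      rw [this, map_add]
      exact (congrArg _ hw).trans (add_neg_cancel _)
    obtain ⟨c, hc0, hc, hFc⟩ := exists_curve_of_mem_ker hp.2.1 hp0 hsurj' hker
    obtain ⟨x, hxp, hxV, hxd, hxc, -⟩ :=
      exists_lift hΩ hO hpO hp hsurj hc0 hc.differentiableAt hFc 0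
    refine ⟨x, fun j => deriv (fun t => x t j) 0, hxp, hxV, fun j => (hxd j).hasDerivAt,
      fun j hj => absurd hj (by omega), ?_⟩
    have : (fun t => x t 0) = fun t => (c t).1 := funext fun t => by rw [← hxc]
    beta_reduce
    rw [this]
    exact ((ContinuousLinearMap.fst ℝ _ _).hasFDerivAt.comp_hasDerivAt 0 hc).deriv
  | 1 =>
    obtain ⟨c, hc0, hc, hFc⟩ := exists_curve_of_mem_ker hp.2.1 hp0 hsurj' (hv one_pos)
    obtain ⟨x, hxp, hxV, hxd, hxc, -⟩ :=
      exists_lift hΩ hO hpO hp hsurj hc0 hc.differentiableAt hFc 0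
    have h0 : (fun t => x t 0) = fun t => (c t).1 := funext fun t => by rw [← hxc]
    have h1 : (fun t => x t 1) = fun t => (c t).2 := funext fun t => by rw [← hxc]
    refine ⟨x, fun j => deriv (fun t => x t j) 0, hxp, hxV, fun j => (hxd j).hasDerivAt,
      fun j hj => ?_, ?_⟩
    · obtain rfl : j = 0 := by omega
      beta_reduce
      rw [h0]
      exact ((ContinuousLinearMap.fst ℝ _ _).hasFDerivAt.comp_hasDerivAt 0 hc).deriv
    · beta_reduce
      rw [h1]
      exact ((ContinuousLinearMap.snd ℝ _ _).hasFDerivAt.comp_hasDerivAt 0 hc).deriv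
  | N + 2 =>
    obtain ⟨x, hxp, hxV, hxd, hxc, hxg⟩ := exists_lift hΩ hO hpO hp hsurj (c := fun _ => (p 0, p 1))
      rfl (differentiableAt_const _) (Eventually.of_forall fun _ => hp0) (Pi.single (N + 2) v)
    have hlow : ∀ j < N + 2, ∀ t, x t j = p j := by
      intro j
      induction j using Nat.strong_induction_on with
      | _ j ih =>
        intro hj t
        match j with
        | 0 => exact congrArg Prod.fst (hxc t)
        | 1 => exact congrArg Prod.snd (hxc t)
        | j + 2 =>
          have h0 : (Pi.single (N + 2) v : Jet n) (j + 2) = 0 :=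
            Pi.single_eq_of_ne (by omega) _
          have := hxg t j (fun i hi => ih i (by omega) (by omega) t) (by rw [h0]; exact map_zero _)
          rw [this, h0, smul_zero, add_zero]
    have htop : ∀ t, x t (N + 2) = p (N + 2) + t • v := fun t => by
      have h0 : (Pi.single (N + 2) v : Jet n) (N + 2) = v := Pi.single_eq_same _ _
      have := hxg t N (fun i hi => hlow i (by omega) t) (by rw [h0]; exact hv (by omega))
      rwa [h0] at this
    refine ⟨x, fun j => deriv (fun t => x t j) 0, hxp, hxV, fun j => (hxd j).hasDerivAt,
      fun j hj => ?_, ?_⟩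
    · simp only [hlow j hj, deriv_const]
    · simp only [htop]
      simpa using (((hasDerivAt_id (0 : ℝ)).smul_const v).const_add (p (N + 2))).deriv

end Curves

/-! ### Matrices of regular functions -/

section Matrices

variable {n r : ℕ} {S : Set (Jet n)}

/-- Evaluation of regular functions at a point. -/
def evalAt (p : S) : regularFunctions S →+* ℝ :=
  (Pi.evalRingHom (fun _ : S => ℝ) p).comp (regularFunctions S).val.toRingHom

theorem evalAt_apply (p : S) (a : regularFunctions S) : evalAt p a = a.1 p := rfl

theorem isUnit_of_forall_ne_zero {a : regularFunctions S} (ha : ∀ p, a.1 p ≠ 0) : IsUnit a := by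
  obtain ⟨a, k, g, h⟩ := a
  refine IsUnit.of_mul_eq_one ⟨fun p => (a p)⁻¹, k, fun z => (g z)⁻¹, fun p => ⟨?_, ?_⟩⟩
    (Subtype.ext <| funext fun p => mul_inv_cancel₀ (ha p))
  · exact (h p).1.inv (by rw [← (h p).2]; exact ha p)
  · exact congrArg _ (h p).2

theorem det_mul_transpose_ne_zero {M : Matrix (Fin r) (Fin n) ℝ}
    (hM : Function.Surjective M.mulVec) : (M * M.transpose).det ≠ 0 := by
  intro hdet
  obtain ⟨u, hu, h⟩ := Matrix.exists_mulVec_eq_zero_iff.2 hdet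
  have h1 : Matrix.vecMul u M = 0 := by
    rw [← dotProduct_self_eq_zero, ← Matrix.dotProduct_mulVec, ← Matrix.mulVec_transpose,
      Matrix.mulVec_mulVec, h, dotProduct_zero]
  obtain ⟨w, rfl⟩ := hM u
  exact hu (dotProduct_self_eq_zero.1 (by
    rw [Matrix.dotProduct_mulVec, h1, zero_dotProduct]))

/-- A matrix of regular functions which is surjective at each point has a right inverse `B`. Over
the reals `B = Mᵀ (M Mᵀ)⁻¹` is one. -/
theorem exists_mul_eq_one {M : Matrix (Fin r) (Fin n) (regularFunctions S)}
    (hM : ∀ p, Function.Surjective (M.map (evalAt p)).mulVec) :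
    ∃ B : Matrix (Fin n) (Fin r) (regularFunctions S), M * B = 1 := by
  have hdet : IsUnit (M * M.transpose).det := isUnit_of_forall_ne_zero fun p => by
    rw [← evalAt_apply, RingHom.map_det, RingHom.mapMatrix_apply, Matrix.map_mul,
      Matrix.transpose_map]
    exact det_mul_transpose_ne_zero (hM p)
  exact ⟨M.transpose * (M * M.transpose)⁻¹, by
    rw [← Matrix.mul_assoc, Matrix.mul_nonsing_inv _ hdet]⟩

end Matrices

/-! ### The exact sequence of a flat system -/

section Flat

variable {n m r : ℕ} {Ω : Set (Fin n → ℝ)} {F : (Fin n → ℝ) × (Fin n → ℝ) → Fin r → ℝ}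
  {V : Set (Jet n)} {W : Set (Jet m)} {e : V ≃ W} (hW : IsOpen W) (he : IsLieBacklundMap e)
  (he' : IsLieBacklundMap e.symm)

/-- The matrix `∑ ∂x_i/∂y_j^(l) τ^l`: the linearization of the parametrization `x = x(y, ẏ, …)`. -/
def paramMatrix : Matrix (Fin n) (Fin m) (TauPoly (cartanDerivation hW he he')) :=
  Matrix.of fun i' i => ofPoly _ (flatGrad hW he he' i (coord V 0 i'))

theorem symbol_mul_paramMatrix (u : TauPoly (cartanDerivation hW he he')) (i' : Fin n)
    (i : Fin m) : symbol (u * paramMatrix hW he he' i' i) =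
      u.1 (flatGrad hW he he' i (coord V 0 i')) := by
  rw [symbol_mul, paramMatrix, Matrix.of_apply, symbol_ofPoly]

/-- The matrix `T = ∑ ∂y_i/∂x_j^(l) τ^l` of the linearization of `y = y(x, ẋ, …)` is a left inverse
of the linearized parametrization. -/
theorem exists_mul_paramMatrix_eq_one :
    ∃ T : Matrix (Fin m) (Fin n) (TauPoly (cartanDerivation hW he he')),
      T * paramMatrix hW he he' = 1 := by
  choose k g hg using fun i => (he 0 i).1
  refine ⟨Matrix.of fun i i' => ∑ j : Fin (k i + 1),
    coef _ ⟨_, k i, _, (hg i).partial (Pi.single j (Pi.single i' 1))⟩ * tau _ ^ (j : ℕ), ?_⟩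
  ext i i₁ : 1
  apply symbol_injective
  have hy : symbol ((1 : Matrix (Fin m) (Fin m) (TauPoly (cartanDerivation hW he he'))) i i₁) =
      flatGrad hW he he' i₁ (pullback e (fun j i => (he j i).1) (coord W 0 i)) := by
    ext1 l
    rw [coeff_flatGrad, flatDerivation_pullback_coord, Matrix.one_apply]
    by_cases h : i = i₁
    · rw [if_pos h, symbol_one, coeff_one]
      simp [h, eq_comm]
    · rw [if_neg h, symbol_zero, coeff_zero, if_neg fun h' => h h'.2]
  rw [hy, flatGrad_eq_sum hW he he' (hg i) i₁, Finset.sum_comm, Matrix.mul_apply, symbol_sum]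
  refine Finset.sum_congr rfl fun i' _ => ?_
  rw [Matrix.of_apply, Finset.sum_mul, symbol_sum]
  refine Finset.sum_congr rfl fun j _ => ?_
  rw [mul_assoc, symbol_coef_mul, symbol_tau_pow_mul, paramMatrix, Matrix.of_apply, symbol_ofPoly,
    tauEnd_pow_flatGrad_coord]

/-- The coefficient matrix `∂F/∂x` of the variational matrix. -/
def partialMatrix₀ (hV : V ⊆ zeroSet Ω F) : Matrix (Fin r) (Fin n) (regularFunctions V) :=
  Matrix.of fun i j => partialF hV i (Pi.single j 1, 0)

/-- The coefficient matrix `∂F/∂ẋ` of the variational matrix. -/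
def partialMatrix₁ (hV : V ⊆ zeroSet Ω F) : Matrix (Fin r) (Fin n) (regularFunctions V) :=
  Matrix.of fun i j => partialF hV i (0, Pi.single j 1)

theorem mulVec_partialMatrix₁ (hV : V ⊆ zeroSet Ω F) (p : V) (v : Fin n → ℝ) :
    ((partialMatrix₁ hV).map (evalAt p)).mulVec v = fderiv ℝ F (p.1 0, p.1 1) (0, v) := by
  funext i
  have hv : ((0, v) : (Fin n → ℝ) × (Fin n → ℝ)) =
      ∑ j, v j • ((0, Pi.single j 1) : (Fin n → ℝ) × (Fin n → ℝ)) := by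
    refine Prod.ext ?_ ?_
    · simp [Prod.fst_sum]
    · simp only [Prod.snd_sum, Prod.smul_mk]
      exact pi_eq_sum_univ' v
  rw [Matrix.mulVec, dotProduct, hv, map_sum, Finset.sum_apply]
  refine Finset.sum_congr rfl fun j _ => ?_
  rw [map_smul]
  exact mul_comm _ _

/-- The parametrization `x(y, ẏ, …)` solves `F(x, ẋ) = 0` identically, so its linearization solves
the linearized system. -/
theorem variationalMatrix_mul_paramMatrix (hV : V ⊆ zeroSet Ω F) :
    variationalMatrix hV (cartanDerivation hW he he') * paramMatrix hW he he' = 0 := by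
  ext i i₁ : 1
  apply symbol_injective
  let L : (Fin (1 + 1) → Fin n → ℝ) →L[ℝ] (Fin n → ℝ) × (Fin n → ℝ) :=
    (ContinuousLinearMap.proj (R := ℝ) (φ := fun _ : Fin (1 + 1) => Fin n → ℝ) 0).prod
      (ContinuousLinearMap.proj (R := ℝ) (φ := fun _ : Fin (1 + 1) => Fin n → ℝ) 1)
  let E : (Fin r → ℝ) →L[ℝ] ℝ := ContinuousLinearMap.proj (R := ℝ) (φ := fun _ : Fin r => ℝ) i
  have hF : ∀ p : V, AnalyticAt ℝ F (L (trunc 1 p.1)) := fun p => (hV p.2).2.1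
  have hrep : Represents V (0 : regularFunctions V).1 1 fun z => E (F (L z)) := fun p =>
    ⟨(E.analyticAt _).comp ((hF p).comp (L.analyticAt _)),
      (congrFun ((hV p.2).2.2 0) i).symm⟩
  have hd : ∀ (p : V) v, fderiv ℝ (fun z => E (F (L z))) (trunc 1 p.1) v =
      fderiv ℝ F (p.1 0, p.1 1) (L v) i := fun p v => by
    have h1 : HasFDerivAt (fun z => E (F (L z)))
        (E.comp ((fderiv ℝ F (L (trunc 1 p.1))).comp L)) (trunc 1 p.1) :=
      E.hasFDerivAt.comp (trunc 1 p.1)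
        ((hF p).differentiableAt.hasFDerivAt.comp (trunc 1 p.1) L.hasFDerivAt)
    rw [h1.fderiv]
    rfl
  have hzero : flatGrad hW he he' i₁ 0 = 0 := by
    ext1 l
    rw [coeff_flatGrad, map_zero, coeff_zero]
  have hsum := flatGrad_eq_sum hW he he' hrep i₁
  rw [hzero, Finset.sum_comm] at hsum
  rw [Matrix.zero_apply, symbol_zero, hsum, Matrix.mul_apply, symbol_sum]
  refine Finset.sum_congr rfl fun j _ => ?_
  rw [Fin.sum_univ_two, variationalMatrix, Matrix.of_apply, add_mul, symbol_add, mul_assoc,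
    symbol_coef_mul, symbol_coef_mul, symbol_tau_mul, paramMatrix, Matrix.of_apply, symbol_ofPoly,
    ← flatGrad_cartanDerivation, cartanDerivation_coord]
  have h0 : L (Pi.single 0 (Pi.single j 1)) = (Pi.single j 1, 0) := by
    refine Prod.ext ?_ ?_ <;> simp [L]
  have h1 : L (Pi.single 1 (Pi.single j 1)) = (0, Pi.single j 1) := by
    refine Prod.ext ?_ ?_ <;> simp [L]
  congr 3
  · exact Subtype.ext <| funext fun p => ((hd p _).trans (by rw [h0]; rfl)).symm
  · exact Subtype.ext <| funext fun p => ((hd p _).trans (by rw [h1]; rfl)).symm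

/-- A row `ρ` of degree at most `N` annihilated by the linearized parametrization, seen as the
one-form `∑ ρ_(j,i) dx_i^(j)`, vanishes on the velocities of curves in `V`; on those that begin with
`x^(N)` it is given by the top coefficient. -/
theorem sum_coeff_mul_eq_zero (hΩ : IsOpen Ω) {O : Set (Jet n)} (hO : IsOpen O)
    (hVO : V = O ∩ zeroSet Ω F)
    (hrank : ∀ x ∈ V, Function.Surjective fun v : Fin n → ℝ => fderiv ℝ F (x 0, x 1) (0, v))
    {ρ : Fin n → TauPoly (cartanDerivation hW he he')}
    (hρ : Matrix.vecMul ρ (paramMatrix hW he he') = 0) {N : ℕ}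
    (hN : ∀ i, (symbol (ρ i)).natDegree ≤ N) (p : V) (v : Fin n → ℝ)
    (hv : 0 < N → fderiv ℝ F (p.1 0, p.1 1) (0, v) = 0) :
    ∑ i, ((symbol (ρ i)).coeff N).1 p * v i = 0 := by
  have hp : p.1 ∈ O ∩ zeroSet Ω F := hVO ▸ p.2
  obtain ⟨x, ξ, hxp, hxV, hxd, hlow, htop⟩ :=
    exists_curve hΩ hO hp.1 hp.2 (hrank p.1 p.2) N v hv
  rw [← hVO] at hxV
  let c : ℕ → Fin n → ℝ := fun j i => ((symbol (ρ i)).coeff j).1 p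
  -- the coefficients are frozen at `p`, which turns the form into the differential of a function
  let a : regularFunctions V := ∑ i, ∑ j ∈ Finset.range (N + 1), c j i • coord V j i
  have ha : ∀ q, a.1 q = ∑ i, ∑ j ∈ Finset.range (N + 1), c j i * q.1 j i := by
    intro q
    simp only [a, AddSubmonoidClass.coe_finsetSum, Finset.sum_apply]
    rfl
  have hpx : (⟨x 0, hxV.self_of_nhds⟩ : V) = p := Subtype.ext hxp
  have hstat := hasDerivAt_zero_of_flatDerivation_eq_zero hW he he' (a := a) hxV hxd (by
    intro l i₁
    rw [hpx]
    have h1 := congrArg (fun u => (symbol u).coeff l) (congrFun hρ i₁)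
    rw [Matrix.vecMul, dotProduct] at h1
    simp only [symbol_sum, symbol_mul_paramMatrix, apply_eq_sum _ (hN _), Pi.zero_apply,
      symbol_zero, tauEnd_pow_flatGrad_coord, finsetSum_coeff, coeff_C_mul, coeff_flatGrad,
      coeff_zero] at h1
    have h2 := congrArg (fun b : regularFunctions V => b.1 p) h1
    simp only [AddSubmonoidClass.coe_finsetSum, Finset.sum_apply] at h2
    simp only [a, map_sum, Derivation.map_smul, AddSubmonoidClass.coe_finsetSum, Finset.sum_apply]
    exact h2)
  have hder : HasDerivAt (fun t => Function.extend Subtype.val a.1 0 (x t))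
      (∑ i, ∑ j ∈ Finset.range (N + 1), c j i * ξ j i) 0 := by
    have h1 : HasDerivAt (fun t => ∑ i, ∑ j ∈ Finset.range (N + 1), c j i * x t j i)
        (∑ i, ∑ j ∈ Finset.range (N + 1), c j i * ξ j i) 0 :=
      HasDerivAt.fun_sum fun i _ => HasDerivAt.fun_sum fun j _ =>
        (hasDerivAt_pi.1 (hxd j) i).const_mul (c j i)
    refine h1.congr_of_eventuallyEq ?_
    filter_upwards [hxV] with t ht
    rw [extend_apply _ ht, ha]
  rw [← hder.unique hstat]
  refine Finset.sum_congr rfl fun i _ => ?_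
  rw [Finset.sum_range_succ, Finset.sum_eq_zero, zero_add, htop]
  intro j hj
  rw [hlow j (Finset.mem_range.1 hj), Pi.zero_apply, mul_zero]

theorem eq_zero_of_vecMul_paramMatrix_eq_zero (hΩ : IsOpen Ω) {O : Set (Jet n)} (hO : IsOpen O)
    (hVO : V = O ∩ zeroSet Ω F)
    (hrank : ∀ x ∈ V, Function.Surjective fun v : Fin n → ℝ => fderiv ℝ F (x 0, x 1) (0, v))
    {ρ : Fin n → TauPoly (cartanDerivation hW he he')}
    (hρ : Matrix.vecMul ρ (paramMatrix hW he he') = 0)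
    (h0 : ∀ i, (symbol (ρ i)).natDegree ≤ 0) : ρ = 0 := by
  funext i
  apply symbol_injective
  rw [eq_C_of_natDegree_le_zero (h0 i), Pi.zero_apply, symbol_zero, ← C_0]
  refine congrArg C (Subtype.ext <| funext fun p => ?_)
  have := sum_coeff_mul_eq_zero hW he he' hΩ hO hVO hrank hρ h0 p (Pi.single i 1)
    fun h => absurd h (lt_irrefl 0)
  simpa [Pi.single_apply] using this

/-- The top coefficient of a row `ρ` of positive degree with `ρ Q = 0` lies in the row space of
`∂F/∂ẋ`, since it annihilates the kernel of `∂F/∂ẋ`. -/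
theorem vecMul_coeff_eq (hΩ : IsOpen Ω) (hV : V ⊆ zeroSet Ω F) {O : Set (Jet n)} (hO : IsOpen O)
    (hVO : V = O ∩ zeroSet Ω F)
    (hrank : ∀ x ∈ V, Function.Surjective fun v : Fin n → ℝ => fderiv ℝ F (x 0, x 1) (0, v))
    {B : Matrix (Fin n) (Fin r) (regularFunctions V)} (hB : partialMatrix₁ hV * B = 1)
    {ρ : Fin n → TauPoly (cartanDerivation hW he he')}
    (hρ : Matrix.vecMul ρ (paramMatrix hW he he') = 0) {N : ℕ}
    (hN : ∀ i, (symbol (ρ i)).natDegree ≤ N) :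
    Matrix.vecMul (fun i => (symbol (ρ i)).coeff N) (B * partialMatrix₁ hV) =
      fun i => (symbol (ρ i)).coeff N := by
  funext j
  refine Subtype.ext <| funext fun p => ?_
  set K : Matrix (Fin n) (Fin n) ℝ := (B * partialMatrix₁ hV).map (evalAt p) with hK
  -- the columns of `1 - B ∂F/∂ẋ` span the kernel of `∂F/∂ẋ`
  have h1 := sum_coeff_mul_eq_zero hW he he' hΩ hO hVO hrank hρ hN p
    ((1 - K).mulVec (Pi.single j 1)) fun _ => by
      rw [← mulVec_partialMatrix₁ hV p, Matrix.mulVec_mulVec, Matrix.mul_sub, Matrix.mul_one,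
        hK, ← Matrix.map_mul, ← Matrix.mul_assoc, hB, Matrix.one_mul, sub_self,
        Matrix.zero_mulVec]
  have h2 : ∀ i, (1 - K).mulVec (Pi.single j 1) i = (if i = j then 1 else 0) - K i j := by
    intro i
    rw [Matrix.mulVec_single_one, Matrix.col_apply, Matrix.sub_apply, Matrix.one_apply]
  simp only [h2, mul_sub, Finset.sum_sub_distrib, mul_ite, mul_one, mul_zero,
    Finset.sum_ite_eq', Finset.mem_univ, if_true, sub_eq_zero] at h1
  rw [h1, Matrix.vecMul, dotProduct, AddSubmonoidClass.coe_finsetSum, Finset.sum_apply]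
  rfl

theorem isHyperRegularOn_of_isFlatOn (hn : r + m = n) (hΩ : IsOpen Ω) (hV : V ⊆ zeroSet Ω F)
    {O : Set (Jet n)} (hO : IsOpen O) (hVO : V = O ∩ zeroSet Ω F)
    (hrank : ∀ x ∈ V, Function.Surjective fun v : Fin n → ℝ => fderiv ℝ F (x 0, x 1) (0, v))
    (hflat : IsFlatOn m V) : IsHyperRegularOn hV := by
  obtain ⟨W, e, hW, he, he'⟩ := hflat
  refine ⟨cartanDerivation hW he he', isCartanDeriv_cartanDerivation hW he he', ?_⟩
  obtain ⟨B, hB⟩ := exists_mul_eq_one (M := partialMatrix₁ hV) fun p u => by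
    obtain ⟨v, hv⟩ := hrank p.1 p.2 u
    exact ⟨v, (mulVec_partialMatrix₁ hV p v).trans hv⟩
  exact exists_isUnit_firstOrder_mul hn hB (variationalMatrix_mul_paramMatrix hW he he' hV)
    (exists_mul_paramMatrix_eq_one hW he he')
    (fun _ => eq_zero_of_vecMul_paramMatrix_eq_zero hW he he' hΩ hO hVO hrank)
    fun _ _ hρ hN => vecMul_coeff_eq hW he he' hΩ hV hO hVO hrank hB hρ hN

end Flat

end FlatSystem

end

theorem proposition1 {n m : ℕ} (hmn : m ≤ n)
    {X : Type*} [TopologicalSpace X] [ChartedSpace (Fin n → ℝ) X]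
    [IsManifold 𝓘(ℝ, Fin n → ℝ) ω X]
    (F : TangentBundle 𝓘(ℝ, Fin n → ℝ) X → Fin (n - m) → ℝ)
    (hF : FlatSystem.IsMeromorphic F)
    (φ : OpenPartialHomeomorph X (Fin n → ℝ))
    (hφ : φ ∈ IsManifold.maximalAtlas 𝓘(ℝ, Fin n → ℝ) ω X)
    (x₀ : FlatSystem.Jet n) (V : Set (FlatSystem.Jet n)) (hx₀ : x₀ ∈ V)
    (hV : V ⊆ FlatSystem.zeroSet φ.target (FlatSystem.coordRep F φ))
    (hVopen : ∃ O : Set (FlatSystem.Jet n), IsOpen O ∧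
      V = O ∩ FlatSystem.zeroSet φ.target (FlatSystem.coordRep F φ))
    (hrank : ∀ x ∈ V, Function.Surjective fun v : Fin n → ℝ =>
      fderiv ℝ (FlatSystem.coordRep F φ) (x 0, x 1) (0, v))
    (hflat : FlatSystem.IsFlatOn m V) :
    FlatSystem.IsHyperRegularOn hV := by
  obtain ⟨O, hO, hVO⟩ := hVopen
  exact FlatSystem.isHyperRegularOn_of_isFlatOn (Nat.sub_add_cancel hmn) φ.open_target hV hO hVO
    hrank hflat
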